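/- Work on \(\mathbb{R}^d\) and let \(ID\) be the set of all infinitely divisible probability measures on \(\mathbb{R}^d\). For \(\nu\in ID\) let \(Y_\nu(t)\), \(t\ge 0\), be an \(\mathbb{R}^d\)-valued Lévy process (stationary independent increments, \(Y_\nu(0)=0\), right-continuous paths with finite left limits) such that \(Y_\nu(1)\) has law \(\nu\); write \(\mathcal{L}(X)\) for the law of \(X\), and let integrals of continuous functions of bounded variation with respect to \(Y_\nu\) be understood pathwise, as Riemann–Stieltjes integrals. For \(\beta>0\) put \[ \mathcal{J}^\beta(\nu):=\mathcal{L}\Big(\int_0^1 t^{1/\beta}\,dY_\nu(t)\Big),\quad \nu\in ID,\qquad \mathcal{J}^\beta(C):=\{\mathcal{J}^\beta(\nu):\nu\in C\}\ \text{ for } C\subseteq ID,\qquad \mathcal{U}_\beta:=\mathcal{J}^\beta(ID)\subseteq ID, \] and let \[ \mathcal{U}_\beta^f:=\{\mathcal{J}^\beta(\rho):\ \rho\in ID,\ \mathcal{J}^\beta(\rho)*\rho\in\mathcal{U}_\beta\} \] be the class of generalized s-selfdecomposable distributions with the factorization property. Then for every \(\beta>0\): (a) \(\displaystyle \mathcal{U}_\beta^f=\mathcal{J}^{2\beta}(\mathcal{U}_\beta)=\mathcal{J}^{2\beta}(\mathcal{J}^\beta(ID))=\Big\{\mathcal{L}\Big(\int_0^1(1-\sqrt{t})^{1/\beta}\,dY_\nu(t)\Big):\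 \nu\in ID\Big\};\) (b) \(\displaystyle \mathcal{U}_\beta=\{\mathcal{J}^\beta(\rho)*\rho:\ \rho\in\mathcal{U}_{2\beta}\}.\) -/

import Mathlib

open MeasureTheory ProbabilityTheory Filter Topology
open scoped NNReal

/-- The `n`-fold convolution power `κ^{*n}` of a measure (with `κ^{*0} = δ₀`). -/
noncomputable def convPow {E : Type} [NormedAddCommGroup E] [MeasurableSpace E]
    (κ : Measure E) : ℕ → Measure E
  | 0 => Measure.dirac 0
  | n + 1 => (convPow κ n) ∗ κ

/-- `ID`: the infinitely divisible probability measures on `E`, i.e. those that have, for every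
`n ≥ 1`, an `n`-th convolution root among the probability measures. -/
def ID (E : Type) [NormedAddCommGroup E] [MeasurableSpace E] : Set (Measure E) :=
  {ν | IsProbabilityMeasure ν ∧
    ∀ n : ℕ, 1 ≤ n → ∃ κ : Measure E, IsProbabilityMeasure κ ∧ convPow κ n = ν}

/-- A path that is right-continuous and has (finite) left limits. -/
def IsCadlagPath {E : Type} [NormedAddCommGroup E] (y : ℝ≥0 → E) : Prop :=
  ∀ t : ℝ≥0, ContinuousWithinAt y (Set.Ici t) t ∧ ∃ l : E, Tendsto y (𝓝[<] t) (𝓝 l)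

/-- A Lévy process: stationary independent increments, start at zero, càdlàg paths. -/
structure IsLevyProcess {E Ω : Type} [NormedAddCommGroup E] [MeasurableSpace E]
    {mΩ : MeasurableSpace Ω} (Y : ℝ≥0 → Ω → E) (P : Measure Ω) : Prop where
  measurable : ∀ t, Measurable (Y t)
  indep_increments : HasIndepIncrements Y P
  stationary_increments : ∀ s t : ℝ≥0, P.map (fun ω => Y (s + t) ω - Y s ω) = P.map (Y t)
  start_zero : ∀ᵐ ω ∂P, Y 0 ω = 0
  cadlag : ∀ᵐ ω ∂P, IsCadlagPath (fun t => Y t ω)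

/-- `z` is the Riemann–Stieltjes integral `∫_0^1 f(t) dy(t)`: the tagged sums
`∑ f(τᵢ) (y(tᵢ₊₁) - y(tᵢ))` over partitions `0 = t₀ ≤ ⋯ ≤ tₙ = 1` with tags
`tᵢ ≤ τᵢ ≤ tᵢ₊₁` converge to `z` as the mesh tends to zero. -/
def HasStieltjesIntegral {E : Type} [NormedAddCommGroup E] [NormedSpace ℝ E]
    (f : ℝ → ℝ) (y : ℝ≥0 → E) (z : E) : Prop :=
  ∀ ε : ℝ, 0 < ε → ∃ δ : ℝ, 0 < δ ∧ ∀ (n : ℕ) (t τ : ℕ → ℝ≥0),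
    t 0 = 0 → t n = 1 →
    (∀ i < n, t i ≤ τ i ∧ τ i ≤ t (i + 1) ∧ (t (i + 1) : ℝ) - (t i : ℝ) < δ) →
    ‖∑ i ∈ Finset.range n, f (τ i) • (y (t (i + 1)) - y (t i)) - z‖ < ε

/-- `μ = 𝓛(∫_0^1 f(t) dY_ν(t))`: `μ` is the law of the pathwise integral of the deterministic
function `f` with respect to a Lévy process `Y_ν` such that `𝓛(Y_ν(1)) = ν`. (For `f` continuous
of bounded variation on `[0,1]` this integral exists along every càdlàg path, and its law depends
on `f` and `ν` only.) -/
def IsRandomIntegralLaw {E : Type} [NormedAddCommGroup E] [NormedSpace ℝ E] [MeasurableSpace E]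
    (f : ℝ → ℝ) (ν μ : Measure E) : Prop :=
  ∃ (Ω : Type) (_ : MeasurableSpace Ω) (P : Measure Ω) (Y : ℝ≥0 → Ω → E) (Z : Ω → E),
    IsProbabilityMeasure P ∧ IsLevyProcess Y P ∧ HasLaw (Y 1) ν P ∧
    (∀ᵐ ω ∂P, HasStieltjesIntegral f (fun t => Y t ω) (Z ω)) ∧ HasLaw Z μ P

/-- `μ = 𝓙^β(ν)`, where `𝓙^β(ν) = 𝓛(∫_0^1 t^{1/β} dY_ν(t))`. -/
def IsJ {E : Type} [NormedAddCommGroup E] [NormedSpace ℝ E] [MeasurableSpace E]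
    (β : ℝ) (ν μ : Measure E) : Prop :=
  IsRandomIntegralLaw (fun t => t ^ (1 / β)) ν μ

/-- The image `𝓙^β(C)` of a set `C` of measures under the random integral mapping `𝓙^β`. -/
def imageJ {E : Type} [NormedAddCommGroup E] [NormedSpace ℝ E] [MeasurableSpace E]
    (β : ℝ) (C : Set (Measure E)) : Set (Measure E) :=
  {μ | ∃ ν ∈ C, IsJ β ν μ}

/-- `𝓤_β = 𝓙^β(ID)`: the generalized s-selfdecomposable distributions. -/
def classU (E : Type) [NormedAddCommGroup E] [NormedSpace ℝ E] [MeasurableSpace E]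
    (β : ℝ) : Set (Measure E) :=
  imageJ β (ID E)

/-- `𝓤_β^f`: the distributions `𝓙^β(ρ)`, `ρ ∈ ID`, with the factorization property
`𝓙^β(ρ) * ρ ∈ 𝓤_β`. -/
def classUf (E : Type) [NormedAddCommGroup E] [NormedSpace ℝ E] [MeasurableSpace E]
    (β : ℝ) : Set (Measure E) :=
  {μ | ∃ ρ ∈ ID E, IsJ β ρ μ ∧ μ ∗ ρ ∈ classU E β}

/-! The characteristic function of an infinitely divisible law never vanishes, so it has a unique
continuous logarithm `ψ` with `ψ 0 = 0`. On these exponents convolution is addition, and a random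
integral is a linear operator: integrating `f` sends `ψ` to `x ↦ ∫₀¹ ψ (f t • x) dt`
(`integralLog`). Write `A`, `B` for the operators of `𝓙^β`, `𝓙^{2β}`. They commute by Fubini.

Fix `x` and put `g v = ψ (v^(1/β) • x)`, `G u = ∫₀ᵘ g`. Substituting `t = u²` gives `Aψ = G 1`, `Bψ
= 2 ∫₀¹ u g(u) du` and `BAψ = 2 ∫₀¹ G(u) du` at `x`. Integration by parts, `∫ G + ∫ u g = G 1`, then
says `ABψ + Bψ = 2Aψ` (`integralLog_integralLog_add`), and it also identifies `BA` with the operator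
of `(1 - √t)^(1/β)` (`integralLog_two_mul_integralLog`).

If `κ` is the convolution square root of `ν`, the first identity reads `𝓙^β(𝓙^{2β} κ) * 𝓙^{2β} κ =
𝓙^β ν`, which is (b) and one half of (a). For the other half, `𝓙^β ρ * ρ = 𝓙^β ν` means `(A + 1) ψ_ρ
= (A + 1) B ψ_κ`; since `A + 1` is injective (`eq_zero_of_integralLog_add_eq_zero`), `ρ = 𝓙^{2β} κ`.

To work with exponents alone, every infinitely divisible law must be carried by an actual Lévy
process with pathwise integrals (`isRandomIntegralLaw_iff`). The process is built on the dyadic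
numbers from convolution roots; an Ottaviani bound on oscillations gives one-sided limits along the
dyadics, and the right limits are the càdlàg version (`exists_isLevyProcess`). The integral exists
because càdlàg paths are uniform limits of step functions and the integrand is monotone
(`exists_hasStieltjesIntegral`). -/

set_option linter.unusedSectionVars false

/-! ### Logarithms of characteristic functions -/

section LogChar

variable {E : Type} [NormedAddCommGroup E] [InnerProductSpace ℝ E] [FiniteDimensional ℝ E]
  [MeasurableSpace E] [BorelSpace E]

/-- `ψ` is the distinguished logarithm of the characteristic function of the probability
measure `μ`. -/
structure IsLogChar (μ : Measure E) (ψ : E → ℂ) : Prop where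
  prob : IsProbabilityMeasure μ
  cont : Continuous ψ
  zero : ψ 0 = 0
  exp_eq : ∀ x, charFun μ x = Complex.exp (ψ x)

theorem continuous_charFun_of_finite (μ : Measure E) [IsFiniteMeasure μ] :
    Continuous (charFun μ) := by
  simp only [funext fun t => charFun_apply (μ := μ) t]
  refine continuous_of_dominated (bound := fun _ => 1) (fun x => ?_) (fun x => ?_) ?_ ?_
  · exact (by fun_prop : Continuous fun y : E => Complex.exp (inner ℝ y x * Complex.I)).aestronglyMeasurable
  · exact ae_of_all _ fun y => by rw [Complex.norm_exp_ofReal_mul_I]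
  · exact integrable_const _
  · exact ae_of_all _ fun y => by fun_prop

/-- The exponential is a covering of the punctured plane, and the real vector space `E` is simply
connected, so `φ` lifts uniquely once the value at `0` is fixed. -/
theorem existsUnique_log {φ : E → ℂ} (hc : Continuous φ) (h0 : φ 0 = 1) (hne : ∀ x, φ x ≠ 0) :
    ∃! ψ : C(E, ℂ), ψ 0 = 0 ∧ Complex.exp ∘ ψ = φ := by
  have := Complex.isCoveringMapOn_exp.existsUnique_continuousMap_lifts (A := E) ⟨φ, hc⟩
    (a₀ := 0) (e₀ := 0) (by simp [h0]) (fun a => hne a)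
  simpa using this

theorem exists_log {φ : E → ℂ} (hc : Continuous φ) (h0 : φ 0 = 1) (hne : ∀ x, φ x ≠ 0) :
    ∃ ψ : E → ℂ, Continuous ψ ∧ ψ 0 = 0 ∧ ∀ x, φ x = Complex.exp (ψ x) := by
  obtain ⟨ψ, ⟨h1, h2⟩, -⟩ := existsUnique_log hc h0 hne
  exact ⟨ψ, ψ.continuous, h1, fun x => (congrFun h2 x).symm⟩

theorem log_unique {ψ₁ ψ₂ : E → ℂ} (h1 : Continuous ψ₁) (h2 : Continuous ψ₂) (h10 : ψ₁ 0 = 0)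
    (h20 : ψ₂ 0 = 0) (h : ∀ x, Complex.exp (ψ₁ x) = Complex.exp (ψ₂ x)) : ψ₁ = ψ₂ := by
  have := (existsUnique_log (φ := fun x => Complex.exp (ψ₂ x)) (by fun_prop) (by simp [h20])
    (fun x => Complex.exp_ne_zero _)).unique (y₁ := ⟨ψ₁, h1⟩) (y₂ := ⟨ψ₂, h2⟩)
    ⟨h10, funext h⟩ ⟨h20, rfl⟩
  exact congrArg DFunLike.coe this

theorem IsLogChar.unique {μ : Measure E} {ψ₁ ψ₂ : E → ℂ} (h1 : IsLogChar μ ψ₁)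
    (h2 : IsLogChar μ ψ₂) : ψ₁ = ψ₂ :=
  log_unique h1.cont h2.cont h1.zero h2.zero fun x => by rw [← h1.exp_eq, h2.exp_eq]

theorem IsLogChar.measure_eq {μ ν : Measure E} {ψ : E → ℂ} (h1 : IsLogChar μ ψ)
    (h2 : IsLogChar ν ψ) : μ = ν := by
  have := h1.prob
  have := h2.prob
  exact Measure.ext_of_charFun (funext fun x => by rw [h1.exp_eq, h2.exp_eq])

theorem isProbabilityMeasure_convPow (κ : Measure E) [IsProbabilityMeasure κ] (n : ℕ) :
    IsProbabilityMeasure (convPow κ n) := by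
  induction n with
  | zero => rw [convPow]; infer_instance
  | succ n ih => rw [convPow]; infer_instance

theorem charFun_convPow (κ : Measure E) [IsProbabilityMeasure κ] (n : ℕ) (x : E) :
    charFun (convPow κ n) x = charFun κ x ^ n := by
  induction n with
  | zero => simp [convPow]
  | succ n ih =>
    have := isProbabilityMeasure_convPow κ n
    rw [convPow, charFun_conv, ih, pow_succ]

theorem IsLogChar.conv {μ ν : Measure E} {ψ₁ ψ₂ : E → ℂ} (h1 : IsLogChar μ ψ₁)
    (h2 : IsLogChar ν ψ₂) : IsLogChar (μ ∗ ν) (fun x => ψ₁ x + ψ₂ x) := by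
  have := h1.prob
  have := h2.prob
  refine ⟨inferInstance, h1.cont.add h2.cont, by simp [h1.zero, h2.zero], fun x => ?_⟩
  rw [charFun_conv, h1.exp_eq, h2.exp_eq, Complex.exp_add]

theorem IsLogChar.convPow {μ : Measure E} {ψ : E → ℂ} (h : IsLogChar μ ψ) (n : ℕ) :
    IsLogChar (convPow μ n) (fun x => n * ψ x) := by
  have := h.prob
  refine ⟨isProbabilityMeasure_convPow μ n, h.cont.const_mul _, by simp [h.zero], fun x => ?_⟩
  rw [charFun_convPow, h.exp_eq, Complex.exp_nat_mul]

/-- The symmetrization of a probability measure. -/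
theorem charFun_conv_map_neg (μ : Measure E) [IsProbabilityMeasure μ] (x : E) :
    charFun (μ ∗ μ.map (fun y => -y)) x = ((‖charFun μ x‖ ^ 2 : ℝ) : ℂ) := by
  have : IsProbabilityMeasure (μ.map (fun y : E => -y)) :=
    Measure.isProbabilityMeasure_map (by fun_prop)
  have h := charFun_map_smul (μ := μ) (-1) x
  simp only [neg_smul, one_smul, charFun_neg] at h
  rw [charFun_conv, h, Complex.mul_conj, Complex.normSq_eq_norm_sq]

theorem re_charFun (μ : Measure E) [IsProbabilityMeasure μ] (x : E) :
    (charFun μ x).re = ∫ y, Real.cos (inner ℝ y x) ∂μ := by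
  have hi : Integrable (fun y : E => Complex.exp (inner ℝ y x * Complex.I)) μ := by
    refine Integrable.of_bound (by fun_prop) 1 (ae_of_all _ fun y => ?_)
    rw [Complex.norm_exp_ofReal_mul_I]
  rw [charFun_apply, ← Complex.reCLM_apply, ← ContinuousLinearMap.integral_comp_comm _ hi]
  simp [Complex.exp_ofReal_mul_I_re]

/-- Integrate `1 - cos 2θ = 2 (1 - cos θ) (1 + cos θ) ≤ 4 (1 - cos θ)`. Applied to symmetrizations,
this controls how fast a characteristic function can leave modulus one. -/
theorem one_sub_re_charFun_two_smul_le (μ : Measure E) [IsProbabilityMeasure μ] (x : E) :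
    1 - (charFun μ ((2 : ℝ) • x)).re ≤ 4 * (1 - (charFun μ x).re) := by
  have hi : ∀ z : E, Integrable (fun y : E => Real.cos (inner ℝ y z)) μ := fun z =>
    Integrable.of_bound (by fun_prop) 1 (ae_of_all _ fun y => by
      simpa using Real.abs_cos_le_one _)
  have h := integral_mono (μ := μ) ((integrable_const (1 : ℝ)).sub (hi ((2 : ℝ) • x)))
    (((integrable_const (1 : ℝ)).sub (hi x)).const_mul 4) (fun y => by
      simp only [Pi.sub_apply, inner_smul_right, Real.cos_two_mul]
      nlinarith [sq_nonneg (Real.cos (inner ℝ y x) - 1)])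
  simp only [Pi.sub_apply] at h
  rw [integral_sub (integrable_const _) (hi _), integral_const_mul,
    integral_sub (integrable_const _) (hi _)] at h
  simpa [re_charFun] using h

theorem one_sub_norm_charFun_two_smul_le (μ : Measure E) [IsProbabilityMeasure μ] (x : E) :
    1 - ‖charFun μ ((2 : ℝ) • x)‖ ^ 2 ≤ 4 * (1 - ‖charFun μ x‖ ^ 2) := by
  have : IsProbabilityMeasure (μ.map (fun y : E => -y)) :=
    Measure.isProbabilityMeasure_map (by fun_prop)
  have h := one_sub_re_charFun_two_smul_le (μ ∗ μ.map (fun y => -y)) x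
  rwa [charFun_conv_map_neg, charFun_conv_map_neg, Complex.ofReal_re, Complex.ofReal_re] at h

theorem charFun_two_smul_ne_zero {ν : Measure E} (hν : ν ∈ ID E) {x : E}
    (hx : charFun ν x ≠ 0) : charFun ν ((2 : ℝ) • x) ≠ 0 := by
  have ha : 0 < ‖charFun ν x‖ ^ 2 := by positivity
  -- A root of high order has squared modulus above `3/4` at `x`, exactly what the factor `4` of the
  -- doubling inequality needs to exclude a zero at `2x`.
  obtain ⟨n, hn⟩ := exists_pow_lt_of_lt_one ha (by norm_num : (3 / 4 : ℝ) < 1)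
  have hn' : (3 / 4 : ℝ) ^ (n + 1) < ‖charFun ν x‖ ^ 2 :=
    (pow_le_pow_of_le_one (by norm_num) (by norm_num) n.le_succ).trans_lt hn
  obtain ⟨κ, hκ, rfl⟩ := hν.2 (n + 1) (by omega)
  rw [charFun_convPow] at hn' ⊢
  have h1 : 3 / 4 < ‖charFun κ x‖ ^ 2 := by
    rw [norm_pow, ← pow_mul, mul_comm, pow_mul] at hn'
    exact lt_of_pow_lt_pow_left₀ _ (by positivity) hn'
  have h2 := one_sub_norm_charFun_two_smul_le κ x
  refine pow_ne_zero _ fun h => ?_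
  rw [h] at h2
  norm_num at h2
  linarith

/-- Near `0` there is no zero by continuity; repeated doubling carries this from `2⁻ⁿ x` to `x`. -/
theorem charFun_ne_zero_of_mem_ID {ν : Measure E} (hν : ν ∈ ID E) (x : E) :
    charFun ν x ≠ 0 := by
  have := hν.1
  have hc : Tendsto (fun n : ℕ => charFun ν (((2 : ℝ)⁻¹ ^ n) • x)) atTop (𝓝 (charFun ν 0)) := by
    refine ((continuous_charFun_of_finite ν).tendsto 0).comp ?_
    simpa using (tendsto_pow_atTop_nhds_zero_of_lt_one (by norm_num : (0 : ℝ) ≤ 2⁻¹)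
      (by norm_num)).smul_const x
  have h0 : charFun ν 0 ≠ 0 := by simp
  obtain ⟨n, hn⟩ := (hc.eventually_ne h0).exists
  induction n with
  | zero => simpa using hn
  | succ n ih =>
    refine ih ?_
    have := charFun_two_smul_ne_zero hν hn
    rwa [smul_smul, pow_succ', ← mul_assoc, mul_inv_cancel₀ two_ne_zero, one_mul] at this

theorem exists_isLogChar {ν : Measure E} (hν : ν ∈ ID E) : ∃ ψ, IsLogChar ν ψ := by
  have := hν.1
  obtain ⟨ψ, h1, h2, h3⟩ := exists_log (continuous_charFun_of_finite ν) (by simp)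
    (charFun_ne_zero_of_mem_ID hν)
  exact ⟨ψ, hν.1, h1, h2, h3⟩

/-- No branch of the root has to be chosen: `n` times the logarithm of `κ` is a logarithm of `ν`,
and that one is unique. -/
theorem IsLogChar.of_convPow {ν κ : Measure E} {ψ : E → ℂ} (h : IsLogChar ν ψ)
    (hκ : IsProbabilityMeasure κ) {n : ℕ} (hn : n ≠ 0) (e : _root_.convPow κ n = ν) :
    IsLogChar κ (fun x => ψ x / n) := by
  subst e
  have hne : ∀ x, charFun κ x ≠ 0 := fun x hx => by
    have := h.exp_eq x
    rw [charFun_convPow, hx, zero_pow hn] at this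
    exact Complex.exp_ne_zero _ this.symm
  obtain ⟨ψ', h1, h2, h3⟩ := exists_log (continuous_charFun_of_finite κ) (by simp) hne
  have h' : IsLogChar κ ψ' := ⟨hκ, h1, h2, h3⟩
  have hn' : (n : ℂ) ≠ 0 := by exact_mod_cast hn
  have := h.unique (h'.convPow n)
  rw [this]
  convert h' using 2 with x
  field_simp

/-- Roots of infinitely divisible measures are infinitely divisible. -/
theorem exists_root_mem_ID {ν : Measure E} {ψ : E → ℂ} (hν : ν ∈ ID E) (h : IsLogChar ν ψ)
    {n : ℕ} (hn : n ≠ 0) : ∃ κ ∈ ID E, IsLogChar κ (fun x => ψ x / n) := by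
  obtain ⟨κ, hκ, e⟩ := hν.2 n (by omega)
  have hlog := h.of_convPow hκ hn e
  refine ⟨κ, ⟨hκ, fun m hm => ?_⟩, hlog⟩
  -- An `m`-th root of the `n`-th root is an `nm`-th root of `ν`: exponents determine the measure.
  obtain ⟨κ', hκ', e'⟩ := hν.2 (n * m) (Nat.mul_pos (by omega) (by omega))
  have hlog' := (h.of_convPow hκ' (by positivity) e').convPow m
  refine ⟨κ', hκ', hlog'.measure_eq ?_⟩
  convert hlog using 2 with x
  have : (m : ℂ) ≠ 0 := by exact_mod_cast (by omega : m ≠ 0)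
  have : (n : ℂ) ≠ 0 := by exact_mod_cast hn
  push_cast
  field_simp

theorem conv_self_mem_ID {ν : Measure E} (hν : ν ∈ ID E) : ν ∗ ν ∈ ID E := by
  have := hν.1
  refine ⟨inferInstance, fun n hn => ?_⟩
  obtain ⟨κ, hκ, rfl⟩ := hν.2 n hn
  have := isProbabilityMeasure_convPow κ n
  have := isProbabilityMeasure_convPow (κ ∗ κ) n
  refine ⟨κ ∗ κ, inferInstance, Measure.ext_of_charFun (funext fun x => ?_)⟩
  rw [charFun_convPow, charFun_conv, charFun_conv, charFun_convPow, mul_pow]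

end LogChar

/-! ### A process indexed by the dyadic numbers -/

/-- A sequence of laws that is consistent under measurable maps `r n` is realized by a sequence
of random variables that is almost surely consistent. -/
theorem exists_consistent_sequence {W : Type} [MeasurableSpace W] [StandardBorelSpace W]
    [Nonempty W] (Q : ℕ → Measure W) [∀ n, IsProbabilityMeasure (Q n)] (r : W → W)
    (hr : Measurable r) (hQ : ∀ n, (Q (n + 1)).map r = Q n) :
    ∃ P : Measure (ℕ → W), IsProbabilityMeasure P ∧ (∀ n, P.map (fun ω => ω n) = Q n) ∧
      ∀ᵐ ω ∂P, ∀ n, r (ω (n + 1)) = ω n := by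
  -- A Markov chain from coarse to fine: `K n` is the conditional law of the level `n + 1` variable
  -- given its image under `r`. Consecutive states then have the law of `(r w, w)`, which sits on
  -- the graph of `r`.
  let K : (n : ℕ) → Kernel W W := fun n => condDistrib id r (Q (n + 1))
  let κ : (n : ℕ) → Kernel ((i : Finset.Iic n) → W) W := fun n =>
    (K n).comap (fun x => x ⟨n, Finset.mem_Iic.2 le_rfl⟩) (by fun_prop)
  have hK : ∀ n, Q n ⊗ₘ K n = (Q (n + 1)).map (fun w => (r w, w)) := fun n => by
    have := compProd_map_condDistrib (μ := Q (n + 1)) (mβ := ‹_›) (X := r) (Y := id) (by fun_prop)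
    rwa [hQ] at this
  let P : Measure (ℕ → W) := Kernel.trajMeasure (X := fun _ => W) (Q 0) κ
  have hpair : ∀ n, P.map (fun ω => (ω n, ω (n + 1))) = (P.map (fun ω => ω n)) ⊗ₘ K n := by
    intro n
    have h := Kernel.map_frestrictLe_trajMeasure_compProd_eq_map_trajMeasure
      (X := fun _ => W) (μ₀ := Q 0) (κ := κ) (a := n)
    have h2 : HasCondDistrib (fun ω : ℕ → W => ω (n + 1)) (Preorder.frestrictLe n) (κ n) P :=
      ⟨by fun_prop, h.symm⟩
    exact (HasCondDistrib.comp_right (κ := K n)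
      (f := fun x : (Finset.Iic n) → W => x ⟨n, Finset.mem_Iic.2 le_rfl⟩)
      (hf := by fun_prop) h2).map_eq
  have hlaw : ∀ n, P.map (fun ω => ω n) = Q n := by
    intro n
    induction n with
    | zero =>
      have h : P.map (Preorder.frestrictLe (π := fun _ => W) 0) =
          (Q 0).map (MeasurableEquiv.piUnique (fun _ : Finset.Iic 0 => W)).symm := by
        simp only [P, Kernel.trajMeasure]
        rw [Measure.map_comp _ _ (by fun_prop), Kernel.traj_map_frestrictLe,
          Kernel.partialTraj_self, Measure.id_comp]
      have h2 := congrArg (fun m : Measure ((Finset.Iic 0) → W) =>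
        m.map (fun x => x ⟨0, Finset.mem_Iic.2 le_rfl⟩)) h
      rw [Measure.map_map (by fun_prop) (by fun_prop),
        Measure.map_map (by fun_prop) (by fun_prop)] at h2
      refine h2.trans ?_
      exact (congrArg (fun f => (Q 0).map f) (funext fun _ => rfl)).trans Measure.map_id
    | succ n ih =>
      have h := congrArg (fun m : Measure (W × W) => m.map Prod.snd) (hpair n)
      simp only [ih, hK] at h
      rw [Measure.map_map (by fun_prop) (by fun_prop),
        Measure.map_map (by fun_prop) (by fun_prop)] at h
      simpa [Function.comp_def] using h
  refine ⟨P, inferInstance, hlaw, ae_all_iff.2 fun n => ?_⟩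
  have hd : MeasurableSet {p : W × W | r p.2 = p.1} :=
    measurableSet_eq_fun (by fun_prop) (by fun_prop)
  have h := hpair n
  rw [hlaw, hK] at h
  have h1 : ∀ᵐ p ∂((Q (n + 1)).map (fun w => (r w, w))), r p.2 = p.1 := by
    rw [ae_map_iff (by fun_prop) hd]
    simp
  rw [← h, ae_map_iff (by fun_prop) hd] at h1
  exact h1

/-! ### Independence of sums over disjoint blocks -/

section Blocks

variable {Ω : Type} {mΩ : MeasurableSpace Ω} {P : Measure Ω}

/-- Grouping independent σ-algebras into disjoint blocks gives independent σ-algebras. -/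
theorem iIndep_iSup_of_pairwise_disjoint [IsProbabilityMeasure P] {ι κ : Type}
    {m : κ → MeasurableSpace Ω}
    (h_le : ∀ j, m j ≤ mΩ) (h : iIndep m P) {T : ι → Set κ} (hT : Pairwise (Function.onFun Disjoint T)) :
    iIndep (fun i => ⨆ j ∈ T i, m j) P := by
  classical
  rw [iIndep_iff]
  intro s
  induction s using Finset.induction with
  | empty => intro f _; simp
  | insert a s ha ih =>
    intro f hf
    have hd : Disjoint (T a) (⋃ i ∈ s, T i) := by
      rw [Set.disjoint_iUnion₂_right]
      exact fun i hi => hT (fun e => ha (e ▸ hi))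
    have hi := indep_iSup_of_disjoint h_le h hd
    rw [Finset.prod_insert ha, ← ih (fun i hi => hf i (Finset.mem_insert_of_mem hi)),
      Finset.set_biInter_insert]
    refine (Indep_iff _ _ _).1 hi _ _ (hf a (Finset.mem_insert_self _ _)) ?_
    refine Finset.measurableSet_biInter s fun i hi => ?_
    refine (iSup₂_le fun j hj => ?_ : (⨆ j ∈ T i, m j) ≤ _) _ (hf i (Finset.mem_insert_of_mem hi))
    exact le_iSup₂_of_le j (Set.mem_biUnion hi hj) le_rfl

variable {E : Type} [NormedAddCommGroup E] [MeasurableSpace E] [BorelSpace E]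
  [SecondCountableTopology E]

theorem measurable_sum_iSup_comap {ξ : ℕ → Ω → E} {T : Set ℕ} {s : Finset ℕ}
    (hs : ∀ i ∈ s, i ∈ T) :
    Measurable[⨆ j ∈ T, MeasurableSpace.comap (ξ j) inferInstance] (fun ω => ∑ i ∈ s, ξ i ω) := by
  refine Finset.measurable_fun_sum s fun i hi => ?_
  exact (comap_measurable (ξ i)).mono
    (le_iSup₂_of_le (f := fun j (_ : j ∈ T) => MeasurableSpace.comap (ξ j) inferInstance)
      i (hs i hi) le_rfl) le_rfl

/-- Sums of independent random variables over disjoint blocks are independent. -/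
theorem iIndepFun_sum_blocks {ξ : ℕ → Ω → E} (hm : ∀ i, Measurable (ξ i)) (h : iIndepFun ξ P)
    {ι : Type} {s : ι → Finset ℕ} (hs : Pairwise (Function.onFun Disjoint s)) :
    iIndepFun (fun i ω => ∑ j ∈ s i, ξ j ω) P := by
  have := h.isProbabilityMeasure
  have hi := iIndep_iSup_of_pairwise_disjoint (fun j => (hm j).comap_le) h.iIndep
    (T := fun i => (s i : Set ℕ)) (fun i j hij => by
      simpa [Function.onFun] using hs hij)
  rw [iIndepFun_iff_iIndep, iIndep_iff]
  intro t f hf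
  refine (iIndep_iff _ _).1 hi t fun i hi => ?_
  exact (measurable_sum_iSup_comap (T := (s i : Set ℕ)) (fun j hj => hj)).comap_le _ (hf i hi)

end Blocks

/-! ### Construction of the process on the dyadic numbers -/

section Dyadic

variable {E : Type} [NormedAddCommGroup E] [InnerProductSpace ℝ E] [FiniteDimensional ℝ E]
  [MeasurableSpace E] [BorelSpace E]

theorem IsLogChar.map_sum {Ω ι : Type} {mΩ : MeasurableSpace Ω} {P : Measure Ω} {ξ : ι → Ω → E}
    {ψ : ι → E → ℂ}
    (hm : ∀ i, Measurable (ξ i)) (h : iIndepFun ξ P)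
    (hl : ∀ i, IsLogChar (P.map (ξ i)) (ψ i)) (s : Finset ι) :
    IsLogChar (P.map (fun ω => ∑ i ∈ s, ξ i ω)) (fun x => ∑ i ∈ s, ψ i x) := by
  have := h.isProbabilityMeasure
  refine ⟨Measure.isProbabilityMeasure_map (by fun_prop),
    continuous_finsetSum _ fun i _ => (hl i).cont, by simp [(hl _).zero], fun x => ?_⟩
  rw [iIndepFun.charFun_map_fun_finsetSum_eq_prod (fun i _ => (hm i).aemeasurable) (h.restrict s),
    Complex.exp_sum, Finset.prod_apply]
  exact Finset.prod_congr rfl fun i _ => (hl i).exp_eq x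

/-- A process indexed by the dyadic numbers, with stationary independent increments, whose
marginal at time `t` has log-characteristic function `t * ψ`. -/
structure IsDyadicProcess {Ω : Type} {mΩ : MeasurableSpace Ω} (X : ℝ≥0 → Ω → E) (P : Measure Ω)
    (ψ : E → ℂ) : Prop where
  measurable : ∀ t, Measurable (X t)
  zero : ∀ᵐ ω ∂P, X 0 ω = 0
  indep : ∀ m : ℕ, iIndepFun
    (fun (k : ℕ) ω => X (((k + 1 : ℕ) : ℝ≥0) / 2 ^ m) ω - X ((k : ℝ≥0) / 2 ^ m) ω) P
  law : ∀ m k : ℕ, IsLogChar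
    (P.map fun ω => X (((k + 1 : ℕ) : ℝ≥0) / 2 ^ m) ω - X ((k : ℝ≥0) / 2 ^ m) ω)
    (fun x => ψ x / 2 ^ m)

theorem sum_range_two_mul_of_consistent {w : ℕ → ℕ → E}
    (h : ∀ n k, w (n + 1) (2 * k) + w (n + 1) (2 * k + 1) = w n k) (m j k : ℕ) :
    ∑ i ∈ Finset.range (2 ^ j * k), w (m + j) i = ∑ i ∈ Finset.range k, w m i := by
  have h1 : ∀ n k, ∑ i ∈ Finset.range (2 * k), w (n + 1) i = ∑ i ∈ Finset.range k, w n i := by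
    intro n k
    induction k with
    | zero => simp
    | succ k ih =>
      rw [Finset.sum_range_succ, ← ih, ← h, mul_add, mul_one, Finset.sum_range_succ,
        Finset.sum_range_succ, add_assoc]
  induction j with
  | zero => simp
  | succ j ih => rw [← ih, pow_succ', mul_assoc, ← add_assoc, h1]

/-- Partial sums of consistent increments depend only on the dyadic time, not on the level used to
write it; this makes the process well defined. -/
theorem sum_range_eq_of_consistent {w : ℕ → ℕ → E}
    (h : ∀ n k, w (n + 1) (2 * k) + w (n + 1) (2 * k + 1) = w n k) {m m' k k' : ℕ}
    (e : (k : ℝ≥0) / 2 ^ m = (k' : ℝ≥0) / 2 ^ m') :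
    ∑ i ∈ Finset.range k, w m i = ∑ i ∈ Finset.range k', w m' i := by
  wlog hm : m ≤ m' generalizing m m' k k'
  · exact (this e.symm (le_of_not_ge hm)).symm
  obtain ⟨j, rfl⟩ := Nat.exists_eq_add_of_le hm
  have : k' = 2 ^ j * k := by
    rw [div_eq_div_iff (by positivity) (by positivity), pow_add] at e
    have h2 : (2 : ℝ≥0) ^ m ≠ 0 := by positivity
    have : (k' : ℝ≥0) = 2 ^ j * k := by
      refine mul_left_cancel₀ h2 ?_
      rw [mul_comm, ← e]; ring
    exact_mod_cast this
  rw [this, sum_range_two_mul_of_consistent h]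

theorem exists_isDyadicProcess {ν : Measure E} {ψ : E → ℂ} (hν : ν ∈ ID E)
    (h : IsLogChar ν ψ) : ∃ (Ω : Type) (_ : MeasurableSpace Ω) (P : Measure Ω) (X : ℝ≥0 → Ω → E),
      IsProbabilityMeasure P ∧ IsDyadicProcess X P ψ := by
  classical
  have hroot : ∀ m : ℕ, ∃ κ : Measure E, IsLogChar κ (fun x => ψ x / 2 ^ m) := fun m => by
    obtain ⟨κ, -, hκ⟩ := exists_root_mem_ID hν h (n := 2 ^ m) (by positivity)
    exact ⟨κ, by simpa using hκ⟩
  choose κ hκ using hroot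
  have := fun m => (hκ m).prob
  let Q : ℕ → Measure (ℕ → E) := fun m => Measure.infinitePi fun _ : ℕ => κ m
  have hQi : ∀ m, iIndepFun (fun (i : ℕ) (w : ℕ → E) => w i) (Q m) := fun m =>
    iIndepFun_infinitePi (X := fun _ => id) (fun _ => measurable_id)
  have hQl : ∀ m i, (Q m).map (fun w => w i) = κ m := fun m i =>
    Measure.infinitePi_map_eval (fun _ : ℕ => κ m) i
  -- Merging neighbouring increments is the passage from level `m + 1` to level `m`; independence
  -- and `κ (m + 1) ∗ κ (m + 1) = κ m` make it preserve the laws.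
  let r : (ℕ → E) → ℕ → E := fun w k => w (2 * k) + w (2 * k + 1)
  have hr : Measurable r := by fun_prop
  have hrs : r = fun w k => ∑ i ∈ ({2 * k, 2 * k + 1} : Finset ℕ), w i := by
    ext w k
    rw [Finset.sum_pair (by omega)]
  have hQ : ∀ m, (Q (m + 1)).map r = Q m := by
    intro m
    have hi := iIndepFun_sum_blocks (P := Q (m + 1)) (fun i => by fun_prop) (hQi (m + 1))
      (s := fun k : ℕ => ({2 * k, 2 * k + 1} : Finset ℕ)) (fun i j hij => by
        rw [Function.onFun, Finset.disjoint_left]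
        intro a
        simp only [Finset.mem_insert, Finset.mem_singleton]
        omega)
    rw [iIndepFun_iff_map_fun_eq_infinitePi_map (by fun_prop)] at hi
    rw [hrs, hi]
    congr 1
    ext1 k
    refine IsLogChar.measure_eq (IsLogChar.map_sum (fun i => by fun_prop) (hQi (m + 1))
      (fun i => by rw [hQl]; exact hκ (m + 1)) _) ?_
    convert hκ m using 2 with x
    rw [Finset.sum_pair (by omega), pow_succ]
    ring
  obtain ⟨P, hP, hPl, hPc⟩ := exists_consistent_sequence Q r hr hQ
  let S : ℕ → ℕ → (ℕ → ℕ → E) → E := fun m k ω => ∑ i ∈ Finset.range k, ω m i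
  -- The chosen dyadic representation is immaterial almost surely, and the value `0` off the dyadics
  -- is never used.
  let X : ℝ≥0 → (ℕ → ℕ → E) → E := fun t ω =>
    if hd : ∃ p : ℕ × ℕ, t = (p.2 : ℝ≥0) / 2 ^ p.1 then S hd.choose.1 hd.choose.2 ω else 0
  have hX : ∀ t, Measurable (X t) := by
    intro t
    by_cases hd : ∃ p : ℕ × ℕ, t = (p.2 : ℝ≥0) / 2 ^ p.1
    · simp only [X, hd, dite_true, S]
      fun_prop
    · simp only [X, hd, dite_false]
      fun_prop
  have hXS : ∀ᵐ ω ∂P, ∀ m k : ℕ, X ((k : ℝ≥0) / 2 ^ m) ω = S m k ω := by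
    filter_upwards [hPc] with ω hω m k
    have hd : ∃ p : ℕ × ℕ, (k : ℝ≥0) / 2 ^ m = (p.2 : ℝ≥0) / 2 ^ p.1 := ⟨(m, k), rfl⟩
    simp only [X, hd, dite_true]
    exact (sum_range_eq_of_consistent (fun n k => congrFun (hω n) k) hd.choose_spec).symm
  have hinc : ∀ m k : ℕ, (fun ω => X (((k + 1 : ℕ) : ℝ≥0) / 2 ^ m) ω - X ((k : ℝ≥0) / 2 ^ m) ω)
      =ᵐ[P] fun ω => ω m k := by
    intro m k
    filter_upwards [hXS] with ω hω
    rw [hω, hω]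
    simp [S, Finset.sum_range_succ]
  refine ⟨ℕ → ℕ → E, inferInstance, P, X, hP, hX, ?_, fun m => ?_, fun m k => ?_⟩
  · filter_upwards [hXS] with ω hω
    simpa [S] using hω 0 0
  · refine (iIndepFun_congr (fun k => hinc m k)).2 ?_
    rw [iIndepFun_iff_map_fun_eq_infinitePi_map (by fun_prop)]
    have e : ∀ k, P.map (fun ω => ω m k) = κ m := fun k => by
      rw [← hQl m k, ← hPl m, Measure.map_map (by fun_prop) (by fun_prop)]
      rfl
    simp only [e]
    exact hPl m
  · rw [Measure.map_congr (hinc m k)]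
    have e : P.map (fun ω => ω m k) = κ m := by
      rw [← hQl m k, ← hPl m, Measure.map_map (by fun_prop) (by fun_prop)]
      rfl
    rw [e]
    exact hκ m

end Dyadic

/-! ### Oscillations of processes with independent increments -/

section Osc

/-- `Osc A x ε p lo hi`: the path `x` has `p` successive jumps of size more than `ε` between
points of `A ∩ [lo, hi]`. -/
def Osc {ι E : Type} [Preorder ι] [NormedAddCommGroup E] (A : Set ι) (x : ι → E) (ε : ℝ) :
    ℕ → ι → ι → Prop
  | 0, _, _ => True
  | p + 1, lo, hi => ∃ a ∈ A, ∃ b ∈ A, lo ≤ a ∧ a ≤ b ∧ b ≤ hi ∧ ε < ‖x b - x a‖ ∧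
      Osc A x ε p b hi

section Basic

variable {ι E : Type} [Preorder ι] [NormedAddCommGroup E] {A B : Set ι} {x : ι → E} {ε : ℝ}
  {p : ℕ} {lo lo' hi hi' a b : ι}

theorem Osc.mono_left (h : lo' ≤ lo) (ho : Osc A x ε p lo hi) : Osc A x ε p lo' hi := by
  cases p with
  | zero => trivial
  | succ p =>
    obtain ⟨a, ha, b, hb, h1, h2⟩ := ho
    exact ⟨a, ha, b, hb, h.trans h1, h2⟩

theorem Osc.mono_set (h : A ⊆ B) (ho : Osc A x ε p lo hi) : Osc B x ε p lo hi := by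
  induction p generalizing lo with
  | zero => trivial
  | succ p ih =>
    obtain ⟨a, ha, b, hb, h1, h2, h3, h4, h5⟩ := ho
    exact ⟨a, h ha, b, h hb, h1, h2, h3, h4, ih h5⟩

theorem Osc.mono_eps {ε' : ℝ} (h : ε' ≤ ε) (ho : Osc A x ε p lo hi) : Osc A x ε' p lo hi := by
  induction p generalizing lo with
  | zero => trivial
  | succ p ih =>
    obtain ⟨a, ha, b, hb, h1, h2, h3, h4, h5⟩ := ho
    exact ⟨a, ha, b, hb, h1, h2, h3, h.trans_lt h4, ih h5⟩

theorem Osc.append (ho : Osc A x ε p lo hi) (hlo : lo ≤ hi) (ha : a ∈ A) (hb : b ∈ A) (h1 : hi ≤ a)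
    (h2 : a ≤ b) (h3 : b ≤ hi') (h4 : ε < ‖x b - x a‖) : Osc A x ε (p + 1) lo hi' := by
  induction p generalizing lo with
  | zero => exact ⟨a, ha, b, hb, hlo.trans h1, h2, h3, h4, trivial⟩
  | succ p ih =>
    obtain ⟨a', ha', b', hb', h1', h2', h3', h4', h5'⟩ := ho
    exact ⟨a', ha', b', hb', h1', h2', h3'.trans (h1.trans (h2.trans h3)), h4', ih h5' h3'⟩

/-- Oscillations along a directed union are oscillations along a member. -/
theorem Osc.exists_of_iUnion {A : ℕ → Set ι} (hA : Monotone A) (ho : Osc (⋃ m, A m) x ε p lo hi) :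
    ∃ m, Osc (A m) x ε p lo hi := by
  induction p generalizing lo with
  | zero => exact ⟨0, trivial⟩
  | succ p ih =>
    obtain ⟨a, ha, b, hb, h1, h2, h3, h4, h5⟩ := ho
    obtain ⟨i, hi⟩ := Set.mem_iUnion.1 ha
    obtain ⟨j, hj⟩ := Set.mem_iUnion.1 hb
    obtain ⟨k, hk⟩ := ih h5
    refine ⟨max i (max j k), a, hA (by simp) hi, b, hA (by simp) hj, h1, h2, h3, h4,
      hk.mono_set (hA (by simp))⟩

end Basic

/-! ### First passage decompositions and the tail of the number of oscillations -/

section Passage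

variable {Ω : Type} {mΩ : MeasurableSpace Ω} {P : Measure Ω}

/-- First passage decomposition: `disjointed D j` is the event that `j` is the first index at which
`D` occurs. -/
theorem measure_iUnion_disjointed_inter_le {D B : ℕ → Set Ω} (hD : ∀ j, MeasurableSet (D j))
    {c : ENNReal} (h : ∀ j, P (disjointed D j ∩ B j) ≤ c * P (disjointed D j)) :
    P (⋃ j, disjointed D j ∩ B j) ≤ c * P (⋃ j, D j) := by
  rw [← iUnion_disjointed (f := D), measure_iUnion (disjoint_disjointed D)
    (fun j => MeasurableSet.disjointed hD j), ← ENNReal.tsum_mul_left]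
  exact (measure_iUnion_le _).trans (ENNReal.tsum_le_tsum h)

theorem le_measure_iUnion_disjointed_inter {D B : ℕ → Set Ω} (hD : ∀ j, MeasurableSet (D j))
    (hB : ∀ j, MeasurableSet (B j)) {c : ENNReal}
    (h : ∀ j, c * P (disjointed D j) ≤ P (disjointed D j ∩ B j)) :
    c * P (⋃ j, D j) ≤ P (⋃ j, disjointed D j ∩ B j) := by
  rw [← iUnion_disjointed (f := D), measure_iUnion (disjoint_disjointed D)
    (fun j => MeasurableSet.disjointed hD j), ← ENNReal.tsum_mul_left, measure_iUnion]
  · exact ENNReal.tsum_le_tsum h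
  · exact fun i j hij => (disjoint_disjointed D hij).mono Set.inter_subset_left Set.inter_subset_left
  · exact fun j => (MeasurableSet.disjointed hD j).inter (hB j)

variable {E : Type} [NormedAddCommGroup E] [MeasurableSpace E] [BorelSpace E]
  [SecondCountableTopology E]

/-- The σ-algebra generated by the increments of `x` with indices in `T`. -/
@[reducible] def incrSigma (x : ℕ → Ω → E) (T : Set ℕ) : MeasurableSpace Ω :=
  ⨆ j ∈ T, MeasurableSpace.comap (fun ω => x (j + 1) ω - x j ω) inferInstance

theorem incrSigma_le {x : ℕ → Ω → E} (hx : ∀ k, Measurable (x k)) (T : Set ℕ) :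
    incrSigma x T ≤ mΩ :=
  iSup₂_le fun j _ => ((hx (j + 1)).sub (hx j)).comap_le

theorem measurable_incrSigma_sub {x : ℕ → Ω → E} {T : Set ℕ} {a b : ℕ} (hab : a ≤ b)
    (hT : Set.Ico a b ⊆ T) : Measurable[incrSigma x T] (fun ω => x b ω - x a ω) := by
  have h := measurable_sum_iSup_comap (ξ := fun j ω => x (j + 1) ω - x j ω) (T := T)
    (s := Finset.Ico a b) (fun i hi => hT (by simpa using hi))
  have e : (fun ω => x b ω - x a ω) =
      fun ω => ∑ i ∈ Finset.Ico a b, (x (i + 1) ω - x i ω) := by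
    ext ω
    rw [Finset.sum_Ico_sub (fun i => x i ω) hab]
  rw [e]
  exact h

theorem measurableSet_incrSigma_lt {x : ℕ → Ω → E} {T : Set ℕ} {a b : ℕ} (hab : a ≤ b)
    (hT : Set.Ico a b ⊆ T) (ε : ℝ) : MeasurableSet[incrSigma x T] {ω | ε < ‖x b ω - x a ω‖} := by
  have h := measurable_incrSigma_sub (x := x) hab hT
  exact (measurable_norm.comp h) measurableSet_Ioi

theorem measurableSet_incrSigma_osc {x : ℕ → Ω → E} {T : Set ℕ} (ε : ℝ) (p : ℕ) {lo hi : ℕ}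
    (hT : Set.Ico lo hi ⊆ T) :
    MeasurableSet[incrSigma x T] {ω | Osc Set.univ (fun k => x k ω) ε p lo hi} := by
  induction p generalizing lo with
  | zero => simp [Osc]
  | succ p ih =>
    have e : {ω | Osc Set.univ (fun k => x k ω) ε (p + 1) lo hi} =
        ⋃ a : ℕ, ⋃ b : ℕ, ⋃ (_ : lo ≤ a ∧ a ≤ b ∧ b ≤ hi), ({ω | ε < ‖x b ω - x a ω‖} ∩
          {ω | Osc Set.univ (fun k => x k ω) ε p b hi}) := by
      ext ω
      simp only [Osc, Set.mem_univ, true_and, Set.mem_ofPred_eq, Set.mem_iUnion, Set.mem_inter_iff,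
        exists_prop, and_assoc]
    rw [e]
    refine MeasurableSet.iUnion fun a => MeasurableSet.iUnion fun b => MeasurableSet.iUnion fun h => ?_
    refine (measurableSet_incrSigma_lt h.2.1 ?_ ε).inter (ih ?_)
    · exact (Set.Ico_subset_Ico h.1 h.2.2).trans hT
    · exact (Set.Ico_subset_Ico (h.1.trans h.2.1) le_rfl).trans hT

theorem measure_inter_incrSigma {x : ℕ → Ω → E} (hx : ∀ k, Measurable (x k))
    (hi : iIndepFun (fun (k : ℕ) ω => x (k + 1) ω - x k ω) P) (j : ℕ) {s t : Set Ω}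
    (hs : MeasurableSet[incrSigma x (Set.Iio j)] s)
    (ht : MeasurableSet[incrSigma x (Set.Ici j)] t) : P (s ∩ t) = P s * P t := by
  have := indep_iSup_of_disjoint (fun k => ((hx (k + 1)).sub (hx k)).comap_le) hi.iIndep
    (S := Set.Iio j) (T := Set.Ici j) (Set.disjoint_left.2 fun a h1 h2 => by
      simp only [Set.mem_Iio, Set.mem_Ici] at h1 h2; omega)
  exact (Indep_iff _ _ _).1 this s t hs ht

theorem measurableSet_disjointed_of_le {m : MeasurableSpace Ω} {D : ℕ → Set Ω} {j : ℕ}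
    (h : ∀ i ≤ j, MeasurableSet[m] (D i)) : MeasurableSet[m] (disjointed D j) := by
  rw [disjointed_eq_inter_compl]
  exact (h j le_rfl).inter (MeasurableSet.iInter fun i => MeasurableSet.iInter fun hi =>
    (h i hi.le).compl)

/-- Ottaviani's inequality. -/
theorem measure_exists_lt_norm_sub_le {x : ℕ → Ω → E} (hx : ∀ k, Measurable (x k))
    (hind : iIndepFun (fun (k : ℕ) ω => x (k + 1) ω - x k ω) P) {ε : ℝ} {lo hi : ℕ}
    (hα : ∀ i j, lo ≤ i → i ≤ j → j ≤ hi → P {ω | ε / 4 < ‖x j ω - x i ω‖} ≤ 1 / 4) :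
    P {ω | ∃ j, lo < j ∧ j ≤ hi ∧ ε / 2 < ‖x j ω - x lo ω‖} ≤ 1 / 2 := by
  have hprob := hind.isProbabilityMeasure
  classical
  by_cases hlh : lo ≤ hi
  swap
  · have : {ω | ∃ j, lo < j ∧ j ≤ hi ∧ ε / 2 < ‖x j ω - x lo ω‖} = ∅ := by
      ext ω; simp; intros; omega
    simp [this]
  -- `D j`: the path is more than `ε/2` away from its start at `j`. `B j`: it moves by at most `ε/4`
  -- from `j` to `hi`, which has probability at least `3/4` and is independent of the past. Both
  -- together leave the path more than `ε/4` away at `hi`.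
  let D : ℕ → Set Ω := fun j =>
    if lo < j ∧ j ≤ hi then {ω | ε / 2 < ‖x j ω - x lo ω‖} else ∅
  let B : ℕ → Set Ω := fun j => {ω | ε / 4 < ‖x hi ω - x j ω‖}ᶜ
  have hDj : ∀ j, MeasurableSet[incrSigma x (Set.Iio j)] (D j) := fun j => by
    by_cases h : lo < j ∧ j ≤ hi
    · simp only [D, h, and_self, if_true]
      exact measurableSet_incrSigma_lt h.1.le (fun i hi => hi.2) _
    · simp only [D, h, if_false]
      exact @MeasurableSet.empty _ (incrSigma x (Set.Iio j))
  have hmono : ∀ i j, i ≤ j → incrSigma x (Set.Iio i) ≤ incrSigma x (Set.Iio j) := fun i j hij =>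
    biSup_mono fun k hk => lt_of_lt_of_le hk hij
  have hD : ∀ j, MeasurableSet (D j) := fun j => incrSigma_le hx _ _ (hDj j)
  have hA : ∀ j, MeasurableSet[incrSigma x (Set.Iio j)] (disjointed D j) := fun j =>
    measurableSet_disjointed_of_le fun i hi => hmono i j hi _ (hDj i)
  have hB : ∀ j, MeasurableSet (B j) := fun j =>
    (measurableSet_lt measurable_const ((hx hi).sub (hx j)).norm).compl
  have key := le_measure_iUnion_disjointed_inter (P := P) hD hB (c := 1 / 2) (fun j => by
    by_cases h : lo < j ∧ j ≤ hi
    · have h1 : MeasurableSet[incrSigma x (Set.Ici j)] (B j) :=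
        (measurableSet_incrSigma_lt h.2 (fun i hi => hi.1) _).compl
      rw [measure_inter_incrSigma hx hind j (hA j) h1, mul_comm]
      gcongr
      rw [measure_compl (incrSigma_le hx _ _ (measurableSet_incrSigma_lt h.2 (fun i hi => hi.1) _))
        (measure_ne_top _ _), measure_univ]
      refine le_trans ?_ (tsub_le_tsub_left (hα j hi h.1.le h.2 le_rfl) 1)
      refine ENNReal.le_sub_of_add_le_left (by norm_num) ?_
      calc (1 / 4 : ENNReal) + 1 / 2 ≤ 1 / 2 + 1 / 2 := by
            gcongr
            norm_num
        _ = 1 := ENNReal.add_halves 1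
    · have : disjointed D j = ∅ := by
        refine Set.subset_eq_empty (disjointed_subset D j) ?_
        simp [D, h]
      simp [this])
  have hsub : (⋃ j, disjointed D j ∩ B j) ⊆ {ω | ε / 4 < ‖x hi ω - x lo ω‖} := by
    refine Set.iUnion_subset fun j ω hω => ?_
    have h1 := disjointed_subset D j hω.1
    by_cases h : lo < j ∧ j ≤ hi
    · simp only [D, h, and_self, if_true, Set.mem_ofPred_eq] at h1
      have h2 : ‖x hi ω - x j ω‖ ≤ ε / 4 := by simpa [B] using hω.2
      have h3 : x j ω - x lo ω = (x hi ω - x lo ω) - (x hi ω - x j ω) := by abel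
      have h4 := norm_sub_le (x hi ω - x lo ω) (x hi ω - x j ω)
      rw [← h3] at h4
      simp only [Set.mem_ofPred_eq]
      linarith
    · simp [D, h] at h1
  have hU : {ω | ∃ j, lo < j ∧ j ≤ hi ∧ ε / 2 < ‖x j ω - x lo ω‖} ⊆ ⋃ j, D j := by
    rintro ω ⟨j, h1, h2, h3⟩
    exact Set.mem_iUnion.2 ⟨j, by simpa [D, h1, h2] using h3⟩
  have h5 : 1 / 2 * P (⋃ j, D j) ≤ 1 / 4 :=
    key.trans ((measure_mono hsub).trans (hα lo hi le_rfl hlh le_rfl))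
  refine (measure_mono hU).trans ?_
  have h6 : P (⋃ j, D j) = 2 * (1 / 2 * P (⋃ j, D j)) := by
    rw [← mul_assoc, one_div, ENNReal.mul_inv_cancel (by norm_num) (by norm_num), one_mul]
  rw [h6]
  refine (mul_le_mul_right h5 2).trans ?_
  rw [one_div, one_div, ← ENNReal.div_eq_inv_mul.trans (mul_comm _ _) ]
  refine ENNReal.div_le_of_le_mul ?_
  rw [show (4 : ENNReal) = 2 * 2 by norm_num, ← mul_assoc, ENNReal.inv_mul_cancel (by norm_num) (by norm_num), one_mul]

/-- Split at the first index `j` that completes a jump larger than `ε`. Such a jump has an endpoint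
more than `ε/2` from the start, so Ottaviani gives a factor `1/2`; the remaining `p` oscillations
lie after `j` and are independent of it. -/
theorem measure_osc_le {x : ℕ → Ω → E} (hx : ∀ k, Measurable (x k))
    (hind : iIndepFun (fun (k : ℕ) ω => x (k + 1) ω - x k ω) P) {ε : ℝ} (hε : 0 < ε) {lo hi : ℕ}
    (hα : ∀ i j, lo ≤ i → i ≤ j → j ≤ hi → P {ω | ε / 4 < ‖x j ω - x i ω‖} ≤ 1 / 4) (p : ℕ) :
    P {ω | Osc Set.univ (fun k => x k ω) ε p lo hi} ≤ (1 / 2) ^ p := by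
  have hprob := hind.isProbabilityMeasure
  classical
  induction p generalizing lo with
  | zero => simpa using prob_le_one
  | succ p ih =>
    let D : ℕ → Set Ω := fun j =>
      if lo < j ∧ j ≤ hi then ⋃ i ∈ Set.Ico lo j, {ω | ε < ‖x j ω - x i ω‖} else ∅
    let B : ℕ → Set Ω := fun j => {ω | Osc Set.univ (fun k => x k ω) ε p j hi}
    have hDj : ∀ j, MeasurableSet[incrSigma x (Set.Iio j)] (D j) := fun j => by
      by_cases h : lo < j ∧ j ≤ hi
      · simp only [D, h, and_self, if_true]
        refine MeasurableSet.biUnion (Set.to_countable _) fun i hi => ?_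
        exact measurableSet_incrSigma_lt hi.2.le (fun i hi => hi.2) _
      · simp only [D, h, if_false]
        exact @MeasurableSet.empty _ (incrSigma x (Set.Iio j))
    have hmono : ∀ i j, i ≤ j → incrSigma x (Set.Iio i) ≤ incrSigma x (Set.Iio j) :=
      fun i j hij => biSup_mono fun k hk => lt_of_lt_of_le hk hij
    have hD : ∀ j, MeasurableSet (D j) := fun j => incrSigma_le hx _ _ (hDj j)
    have hA : ∀ j, MeasurableSet[incrSigma x (Set.Iio j)] (disjointed D j) := fun j =>
      measurableSet_disjointed_of_le fun i hi => hmono i j hi _ (hDj i)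
    have key := measure_iUnion_disjointed_inter_le (P := P) (B := B) hD (c := (1 / 2) ^ p)
      (fun j => by
        by_cases h : lo < j ∧ j ≤ hi
        · rw [measure_inter_incrSigma hx hind j (hA j)
            (measurableSet_incrSigma_osc ε p (fun i hi => hi.1)), mul_comm]
          gcongr
          exact ih fun i k h1 h2 h3 => hα i k (h.1.le.trans h1) h2 h3
        · have : disjointed D j = ∅ := by
            refine Set.subset_eq_empty (disjointed_subset D j) ?_
            simp [D, h]
          simp [this])
    have hDU : (⋃ j, D j) ⊆ {ω | ∃ j, lo < j ∧ j ≤ hi ∧ ε / 2 < ‖x j ω - x lo ω‖} := by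
      refine Set.iUnion_subset fun j ω hω => ?_
      by_cases h : lo < j ∧ j ≤ hi
      · simp only [D, h, and_self, if_true, Set.mem_iUnion, Set.mem_ofPred_eq] at hω
        obtain ⟨i, hi, hω⟩ := hω
        by_contra hcon
        simp only [Set.mem_ofPred_eq, not_exists, not_and, not_lt] at hcon
        have h1 := hcon j h.1 h.2
        have h2 : ‖x i ω - x lo ω‖ ≤ ε / 2 := by
          rcases hi.1.eq_or_lt with rfl | h2
          · simpa using by positivity
          · exact hcon i h2 (hi.2.le.trans h.2)
        have h3 : x j ω - x i ω = (x j ω - x lo ω) - (x i ω - x lo ω) := by abel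
        have h4 := norm_sub_le (x j ω - x lo ω) (x i ω - x lo ω)
        rw [← h3] at h4
        linarith
      · simp [D, h] at hω
    have hsub : {ω | Osc Set.univ (fun k => x k ω) ε (p + 1) lo hi} ⊆
        ⋃ j, disjointed D j ∩ B j := by
      rintro ω ⟨a, -, b, -, h1, h2, h3, h4, h5⟩
      have hab : a < b := lt_of_le_of_ne h2 fun e => by
        rw [e, sub_self, norm_zero] at h4
        linarith
      have hb : ω ∈ ⋃ j, disjointed D j := by
        rw [iUnion_disjointed]
        refine Set.mem_iUnion.2 ⟨b, ?_⟩
        simp only [D, h1.trans_lt hab, h3, and_self, if_true, Set.mem_iUnion, Set.mem_ofPred_eq]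
        exact ⟨a, ⟨h1, hab⟩, h4⟩
      obtain ⟨j, hj⟩ := Set.mem_iUnion.1 hb
      refine Set.mem_iUnion.2 ⟨j, hj, ?_⟩
      -- The first passage is no later than the end `b` of the given jump, so the oscillations after
      -- `b` also count after `j`.
      have hjb : j ≤ b := by
        by_contra hlt
        rw [disjointed_eq_inter_compl] at hj
        have := Set.mem_iInter₂.1 hj.2 b (by omega)
        refine this ?_
        simp only [D, h1.trans_lt hab, h3, and_self, if_true, Set.mem_iUnion, Set.mem_ofPred_eq]
        exact ⟨a, ⟨h1, hab⟩, h4⟩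
      exact h5.mono_left hjb
    refine (measure_mono hsub).trans (key.trans ?_)
    rw [pow_succ]
    gcongr
    exact (measure_mono hDU).trans (measure_exists_lt_norm_sub_le hx hind hα)

end Passage

end Osc

/-! ### Oscillations along the dyadic numbers -/

section DyadicOsc

/-- The dyadic numbers of level `m`. -/
def dyadicLevel (m : ℕ) : Set ℝ≥0 := Set.range fun k : ℕ => (k : ℝ≥0) / 2 ^ m

/-- The nonnegative dyadic numbers. -/
def dyadics : Set ℝ≥0 := ⋃ m, dyadicLevel m

theorem dyadicLevel_mono : Monotone dyadicLevel := by
  refine monotone_nat_of_le_succ fun m => ?_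
  rintro _ ⟨k, rfl⟩
  refine ⟨2 * k, ?_⟩
  simp only [pow_succ]
  push_cast
  field_simp

theorem mem_dyadics (m k : ℕ) : (k : ℝ≥0) / 2 ^ m ∈ dyadics :=
  Set.mem_iUnion.2 ⟨m, k, rfl⟩

theorem div_two_pow_le_iff {m i j : ℕ} : (i : ℝ≥0) / 2 ^ m ≤ (j : ℝ≥0) / 2 ^ m ↔ i ≤ j := by
  rw [div_le_div_iff_of_pos_right (by positivity)]
  exact Nat.cast_le

theorem Osc.of_dyadicLevel {E : Type} [NormedAddCommGroup E] {x : ℝ≥0 → E} {ε : ℝ} {p m i j : ℕ}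
    (h : Osc (dyadicLevel m) x ε p ((i : ℝ≥0) / 2 ^ m) ((j : ℝ≥0) / 2 ^ m)) :
    Osc Set.univ (fun k : ℕ => x ((k : ℝ≥0) / 2 ^ m)) ε p i j := by
  induction p generalizing i with
  | zero => trivial
  | succ p ih =>
    obtain ⟨_, ⟨a, rfl⟩, _, ⟨b, rfl⟩, h1, h2, h3, h4, h5⟩ := h
    exact ⟨a, trivial, b, trivial, div_two_pow_le_iff.1 h1, div_two_pow_le_iff.1 h2,
      div_two_pow_le_iff.1 h3, h4, ih h5⟩

variable {E : Type} [NormedAddCommGroup E] [InnerProductSpace ℝ E] [FiniteDimensional ℝ E]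
  [MeasurableSpace E] [BorelSpace E]

/-- Measures with log-characteristic function `s * ψ` concentrate at `0` as `s → 0`. -/
theorem exists_forall_measure_lt_norm_le {ψ : E → ℂ} {ε : ℝ} (hε : 0 < ε) :
    ∃ δ : ℝ, 0 < δ ∧ ∀ (μ : Measure E) (s : ℝ), 0 ≤ s → s ≤ δ →
      IsLogChar μ (fun x => s * ψ x) → μ {x | ε < ‖x‖} ≤ 1 / 4 := by
  -- Otherwise there are counterexamples with `s → 0`. Their characteristic functions tend to `1`,
  -- so they converge weakly to the point mass at `0`, against the portmanteau bound on the closed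
  -- set `ε ≤ ‖x‖`.
  by_contra! hcon
  have h1 : ∀ n : ℕ, ∃ (μ : ProbabilityMeasure E) (s : ℝ), 0 ≤ s ∧ s ≤ 1 / ((n : ℝ) + 1) ∧
      IsLogChar (μ : Measure E) (fun x => s * ψ x) ∧ 1 / 4 < (μ : Measure E) {x | ε < ‖x‖} := by
    intro n
    obtain ⟨μ, s, h1, h2, h3, h4⟩ := hcon (1 / ((n : ℝ) + 1)) (by positivity)
    exact ⟨⟨μ, h3.prob⟩, s, h1, h2, h3, h4⟩
  choose μ s h0 hs hl hμ using h1
  let μ₀ : ProbabilityMeasure E := ⟨Measure.dirac 0, inferInstance⟩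
  have hs0 : Tendsto s atTop (𝓝 0) :=
    tendsto_of_tendsto_of_tendsto_of_le_of_le tendsto_const_nhds
      tendsto_one_div_add_atTop_nhds_zero_nat h0 hs
  have ht : Tendsto μ atTop (𝓝 μ₀) := by
    refine ProbabilityMeasure.tendsto_of_tendsto_charFun fun x => ?_
    simp only [(hl _).exp_eq, μ₀, ProbabilityMeasure.coe_mk, charFun_dirac, inner_zero_left]
    have : Tendsto (fun n => Complex.exp ((s n : ℂ) * ψ x)) atTop (𝓝 (Complex.exp ((0 : ℝ) * ψ x))) :=
      (Complex.continuous_exp.tendsto _).comp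
        (((Complex.continuous_ofReal.tendsto 0).comp hs0).mul_const _)
    simpa using this
  have hF : IsClosed {x : E | ε ≤ ‖x‖} := isClosed_le continuous_const continuous_norm
  have h2 := ProbabilityMeasure.limsup_measure_closed_le_of_tendsto ht hF
  have h3 : (μ₀ : Measure E) {x : E | ε ≤ ‖x‖} = 0 := by
    simp only [μ₀, ProbabilityMeasure.coe_mk]
    rw [Measure.dirac_apply' _ hF.measurableSet]
    simp [hε]
  rw [h3] at h2
  have h4 : (1 / 4 : ENNReal) ≤ limsup (fun n => (μ n : Measure E) {x : E | ε ≤ ‖x‖}) atTop := by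
    refine le_limsup_of_frequently_le (Frequently.of_forall fun n => ?_)
    exact (hμ n).le.trans (measure_mono fun x (hx : ε < ‖x‖) => show ε ≤ ‖x‖ from hx.le)
  have := h4.trans h2
  simp at this

variable {Ω : Type} {mΩ : MeasurableSpace Ω} {P : Measure Ω} {X : ℝ≥0 → Ω → E} {ψ : E → ℂ}

theorem IsDyadicProcess.law_sub (h : IsDyadicProcess X P ψ) {m i j : ℕ} (hij : i ≤ j) :
    IsLogChar (P.map fun ω => X ((j : ℝ≥0) / 2 ^ m) ω - X ((i : ℝ≥0) / 2 ^ m) ω)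
      (fun x => (((j - i : ℕ) : ℝ) / 2 ^ m : ℝ) * ψ x) := by
  have h1 : IsLogChar (P.map fun ω => ∑ k ∈ Finset.Ico i j,
      (X (((k + 1 : ℕ) : ℝ≥0) / 2 ^ m) ω - X ((k : ℝ≥0) / 2 ^ m) ω))
      (fun x => ∑ k ∈ Finset.Ico i j, ψ x / 2 ^ m) := IsLogChar.map_sum (fun k => (h.measurable _).sub (h.measurable _)) (h.indep m)
    (h.law m) (Finset.Ico i j)
  have e : ∀ ω, ∑ k ∈ Finset.Ico i j, (X (((k + 1 : ℕ) : ℝ≥0) / 2 ^ m) ω - X ((k : ℝ≥0) / 2 ^ m) ω)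
      = X ((j : ℝ≥0) / 2 ^ m) ω - X ((i : ℝ≥0) / 2 ^ m) ω := fun ω =>
    Finset.sum_Ico_sub (fun k : ℕ => X ((k : ℝ≥0) / 2 ^ m) ω) hij
  simp only [e] at h1
  convert h1 using 1
  ext x
  rw [Finset.sum_const, Nat.card_Ico, nsmul_eq_mul]
  push_cast
  ring

/-- Almost surely, the paths of a dyadic process have finitely many oscillations on compacts. -/
theorem IsDyadicProcess.ae_exists_not_osc [IsProbabilityMeasure P] (h : IsDyadicProcess X P ψ) :
    ∀ᵐ ω ∂P, ∀ ε : ℝ, 0 < ε → ∃ r : ℕ, ∀ j : ℕ, ∃ p : ℕ, ¬ Osc dyadics (fun t => X t ω) ε p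
      ((j : ℝ≥0) / 2 ^ r) (((j + 1 : ℕ) : ℝ≥0) / 2 ^ r) := by
  have key : ∀ ε : ℝ, 0 < ε → ∃ r : ℕ, ∀ j : ℕ, ∀ᵐ ω ∂P, ∃ p : ℕ,
      ¬ Osc dyadics (fun t => X t ω) ε p ((j : ℝ≥0) / 2 ^ r) (((j + 1 : ℕ) : ℝ≥0) / 2 ^ r) := by
    intro ε hε
    obtain ⟨δ, hδ, hs⟩ := exists_forall_measure_lt_norm_le (ψ := ψ) (ε := ε / 4) (by positivity)
    -- On cells of length `2⁻ʳ < δ` every increment satisfies the hypothesis of `measure_osc_le`, at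
    -- all finer levels simultaneously.
    obtain ⟨r, hr⟩ := exists_pow_lt_of_lt_one hδ (by norm_num : (1 / 2 : ℝ) < 1)
    refine ⟨r, fun j => ?_⟩
    have hbound : ∀ p : ℕ, P {ω | Osc dyadics (fun t => X t ω) ε p ((j : ℝ≥0) / 2 ^ r)
        (((j + 1 : ℕ) : ℝ≥0) / 2 ^ r)} ≤ (1 / 2) ^ p := by
      intro p
      have hsub : {ω | Osc dyadics (fun t => X t ω) ε p ((j : ℝ≥0) / 2 ^ r)
          (((j + 1 : ℕ) : ℝ≥0) / 2 ^ r)} ⊆ ⋃ m, {ω | Osc (dyadicLevel (r + m)) (fun t => X t ω) ε p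
            ((j : ℝ≥0) / 2 ^ r) (((j + 1 : ℕ) : ℝ≥0) / 2 ^ r)} := by
        intro ω hω
        obtain ⟨m, hm⟩ := Osc.exists_of_iUnion dyadicLevel_mono hω
        exact Set.mem_iUnion.2 ⟨m, hm.mono_set (dyadicLevel_mono (by omega))⟩
      refine (measure_mono hsub).trans ?_
      -- The levels increase and the bound `2⁻ᵖ` does not depend on the level, so it survives
      -- continuity from below.
      rw [Monotone.measure_iUnion (fun a b hab ω hω => by
        exact Osc.mono_set (dyadicLevel_mono (by omega)) hω)]
      refine iSup_le fun m => ?_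
      have e : ∀ i : ℕ, (i : ℝ≥0) / 2 ^ r = ((2 ^ m * i : ℕ) : ℝ≥0) / 2 ^ (r + m) := fun i => by
        push_cast
        rw [pow_add]
        field_simp
      rw [e, e]
      refine (measure_mono (fun ω hω => Osc.of_dyadicLevel hω)).trans
        (measure_osc_le (x := fun k => X ((k : ℝ≥0) / 2 ^ (r + m))) (fun k => h.measurable _)
          (h.indep (r + m)) hε (fun a b h1 h2 h3 => ?_) p)
      have hl := h.law_sub (m := r + m) h2
      have h4 := hs _ _ (by positivity) ?_ hl
      · have hm : Measurable fun ω =>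
            X ((b : ℝ≥0) / 2 ^ (r + m)) ω - X ((a : ℝ≥0) / 2 ^ (r + m)) ω :=
          (h.measurable _).sub (h.measurable _)
        rwa [Measure.map_apply hm
          (measurableSet_lt measurable_const measurable_norm)] at h4
      · refine le_trans ?_ hr.le
        have h5 : b - a ≤ 2 ^ m := by
          rw [mul_add, mul_one] at h3
          omega
        have h6 : ((b - a : ℕ) : ℝ) ≤ 2 ^ m := by exact_mod_cast h5
        rw [div_le_iff₀ (by positivity), pow_add, ← mul_assoc, ← mul_pow]
        norm_num
        exact_mod_cast h6
    have h0 : P (⋂ p : ℕ, {ω | Osc dyadics (fun t => X t ω) ε p ((j : ℝ≥0) / 2 ^ r)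
        (((j + 1 : ℕ) : ℝ≥0) / 2 ^ r)}) = 0 := by
      refine le_antisymm (ge_of_tendsto' (ENNReal.tendsto_pow_atTop_nhds_zero_of_lt_one
        (r := 1 / 2) (by norm_num)) fun p => ?_) zero_le
      exact (measure_mono (Set.iInter_subset _ p)).trans (hbound p)
    refine measure_mono_null (fun ω hω => ?_) h0
    simpa using hω
  have key' : ∀ n : ℕ, ∃ r : ℕ, ∀ j : ℕ, ∀ᵐ ω ∂P, ∃ p : ℕ,
      ¬ Osc dyadics (fun t => X t ω) (1 / ((n : ℝ) + 1)) p
        ((j : ℝ≥0) / 2 ^ r) (((j + 1 : ℕ) : ℝ≥0) / 2 ^ r) := fun n => key _ (by positivity)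
  choose r hr using key'
  have hall : ∀ᵐ ω ∂P, ∀ n j : ℕ, ∃ p : ℕ, ¬ Osc dyadics (fun t => X t ω) (1 / ((n : ℝ) + 1)) p
        ((j : ℝ≥0) / 2 ^ (r n)) (((j + 1 : ℕ) : ℝ≥0) / 2 ^ (r n)) :=
    ae_all_iff.2 fun n => ae_all_iff.2 fun j => hr n j
  filter_upwards [hall] with ω hω ε hε
  obtain ⟨n, hn⟩ := exists_nat_one_div_lt hε
  refine ⟨r n, fun j => ?_⟩
  obtain ⟨p, hp⟩ := hω n j
  exact ⟨p, fun ho => hp (ho.mono_eps hn.le)⟩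

end DyadicOsc

/-! ### Regularization of paths -/

section Paths

/-- The smallest dyadic number of level `m` that is larger than `t`. -/
noncomputable def dyadicAbove (m : ℕ) (t : ℝ≥0) : ℝ≥0 := ((⌊t * 2 ^ m⌋₊ + 1 : ℕ) : ℝ≥0) / 2 ^ m

theorem lt_dyadicAbove (m : ℕ) (t : ℝ≥0) : t < dyadicAbove m t := by
  rw [dyadicAbove, lt_div_iff₀ (by positivity)]
  exact_mod_cast Nat.lt_floor_add_one (t * 2 ^ m)

theorem dyadicAbove_le (m : ℕ) (t : ℝ≥0) : dyadicAbove m t ≤ t + (1 / 2) ^ m := by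
  have := Nat.floor_le (zero_le : 0 ≤ t * 2 ^ m)
  rw [dyadicAbove, div_le_iff₀ (by positivity), add_mul, ← mul_pow]
  push_cast
  simpa using this

theorem tendsto_dyadicAbove_nhds (t : ℝ≥0) : Tendsto (fun m => dyadicAbove m t) atTop (𝓝 t) := by
  have h : Tendsto (fun m : ℕ => t + (1 / 2 : ℝ≥0) ^ m) atTop (𝓝 (t + 0)) :=
    tendsto_const_nhds.add (tendsto_pow_atTop_nhds_zero_of_lt_one (by simp)
      (NNReal.half_lt_self one_ne_zero))
  rw [add_zero] at h
  exact tendsto_of_tendsto_of_tendsto_of_le_of_le tendsto_const_nhds h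
    (fun m => (lt_dyadicAbove m t).le) (fun m => dyadicAbove_le m t)

theorem tendsto_dyadicAbove (t : ℝ≥0) :
    Tendsto (fun m => dyadicAbove m t) atTop (𝓝[dyadics ∩ Set.Ioi t] t) :=
  tendsto_nhdsWithin_iff.2 ⟨tendsto_dyadicAbove_nhds t,
    Eventually.of_forall fun m => ⟨mem_dyadics _ _, lt_dyadicAbove m t⟩⟩

instance neBot_nhdsWithin_dyadics (t : ℝ≥0) : NeBot (𝓝[dyadics ∩ Set.Ioi t] t) :=
  (tendsto_dyadicAbove t).neBot

variable {E : Type} [NormedAddCommGroup E] {x : ℝ≥0 → E}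

/-- A map without a limit has arbitrarily close points with a jump. -/
theorem exists_jump_of_not_tendsto [CompleteSpace E] {S : Set ℝ≥0} {t : ℝ≥0} [NeBot (𝓝[S] t)]
    (h : ¬ ∃ l, Tendsto x (𝓝[S] t) (𝓝 l)) : ∃ ε : ℝ, 0 < ε ∧ ∀ U ∈ 𝓝 t, ∃ a ∈ S, ∃ b ∈ S,
      a ∈ U ∧ b ∈ U ∧ a ≤ b ∧ ε < ‖x b - x a‖ := by
  rw [← cauchy_map_iff_exists_tendsto, Metric.cauchy_iff] at h
  push Not at h
  obtain ⟨ε, hε, h⟩ := h inferInstance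
  refine ⟨ε / 2, by positivity, fun U hU => ?_⟩
  obtain ⟨_, ⟨a, ha, rfl⟩, _, ⟨b, hb, rfl⟩, hab⟩ := h (x '' (S ∩ U))
    (image_mem_map (inter_mem_nhdsWithin S hU))
  rw [dist_eq_norm] at hab
  rcases le_total a b with h1 | h1
  · exact ⟨a, ha.1, b, hb.1, ha.2, hb.2, h1, by rw [norm_sub_rev]; linarith⟩
  · exact ⟨b, hb.1, a, ha.1, hb.2, ha.2, h1, by linarith⟩

/-- Finitely many oscillations along the dyadic numbers, locally uniformly. -/
def FinOsc (x : ℝ≥0 → E) : Prop := ∀ ε : ℝ, 0 < ε → ∃ r : ℕ, ∀ j : ℕ, ∃ p : ℕ,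
  ¬ Osc dyadics x ε p ((j : ℝ≥0) / 2 ^ r) (((j + 1 : ℕ) : ℝ≥0) / 2 ^ r)

/-- Without a right limit, jumps of a fixed size occur arbitrarily close to `t`. Choosing them
successively closer to `t` puts any number of oscillations into one dyadic cell. -/
theorem FinOsc.exists_tendsto_right [CompleteSpace E] (h : FinOsc x) (t : ℝ≥0) :
    ∃ l, Tendsto x (𝓝[dyadics ∩ Set.Ioi t] t) (𝓝 l) := by
  by_contra hcon
  obtain ⟨ε, hε, hj⟩ := exists_jump_of_not_tendsto hcon
  have key : ∀ p : ℕ, ∀ hi, t < hi → ∃ lo, t < lo ∧ lo ≤ hi ∧ Osc dyadics x ε p lo hi := by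
    intro p
    induction p with
    | zero => exact fun hi h => ⟨hi, h, le_rfl, trivial⟩
    | succ p ih =>
      intro hi hhi
      obtain ⟨a, ha, b, hb, -, h2, h3, h4⟩ := hj (Set.Iio hi) (Iio_mem_nhds hhi)
      obtain ⟨lo, h5, h6, h7⟩ := ih a ha.2
      exact ⟨lo, h5, h6.trans (h3.trans (le_of_lt h2)), h7.append h6 ha.1 hb.1 le_rfl h3
        (le_of_lt h2) h4⟩
  obtain ⟨r, hr⟩ := h ε hε
  obtain ⟨p, hp⟩ := hr ⌊t * 2 ^ r⌋₊
  obtain ⟨lo, h1, -, h2⟩ := key p _ (lt_dyadicAbove r t)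
  refine hp (h2.mono_left (le_trans ?_ h1.le))
  rw [div_le_iff₀ (by positivity)]
  exact Nat.floor_le zero_le

theorem FinOsc.exists_tendsto_left [CompleteSpace E] (h : FinOsc x) (t : ℝ≥0) :
    ∃ l, Tendsto x (𝓝[dyadics ∩ Set.Iio t] t) (𝓝 l) := by
  by_contra hcon
  -- At `t = 0` the filter is trivial and every point is a limit.
  have hne : NeBot (𝓝[dyadics ∩ Set.Iio t] t) := ⟨fun hbot => hcon ⟨0, by rw [hbot]; exact tendsto_bot⟩⟩
  obtain ⟨ε, hε, hj⟩ := exists_jump_of_not_tendsto hcon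
  have key : ∀ p : ℕ, ∀ hi, t ≤ hi → ∀ lo, lo < t → Osc dyadics x ε p lo hi := by
    intro p hi hhi
    induction p with
    | zero => exact fun lo h => trivial
    | succ p ih =>
      intro lo hlo
      obtain ⟨a, ha, b, hb, h1, h2, h3, h4⟩ := hj (Set.Ioi lo) (Ioi_mem_nhds hlo)
      exact ⟨a, ha.1, b, hb.1, le_of_lt h1, h3, (le_of_lt hb.2).trans hhi, h4, ih b hb.2⟩
  obtain ⟨r, hr⟩ := h ε hε
  have ht : 0 < t := by
    obtain ⟨a, ha, -⟩ := hj Set.univ univ_mem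
    exact lt_of_le_of_lt zero_le ha.2
  -- The cell must reach strictly to the left of `t`, hence the ceiling minus one in place of the
  -- floor.
  obtain ⟨p, hp⟩ := hr (⌈t * 2 ^ r⌉₊ - 1)
  have hc : 0 < ⌈t * 2 ^ r⌉₊ := Nat.ceil_pos.2 (by positivity)
  refine hp (key p _ ?_ _ ?_)
  · rw [le_div_iff₀ (by positivity), Nat.sub_add_cancel hc]
    exact Nat.le_ceil _
  · rw [div_lt_iff₀ (by positivity)]
    exact Nat.lt_ceil.1 (by omega)

theorem dist_le_of_tendsto_right {y : ℝ≥0 → E}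
    (hy : ∀ t, Tendsto x (𝓝[dyadics ∩ Set.Ioi t] t) (𝓝 (y t))) {a b : ℝ≥0} {c : E} {ε : ℝ}
    (h : ∀ q ∈ dyadics, a < q → q < b → dist (x q) c < ε) {s : ℝ≥0} (h1 : a ≤ s) (h2 : s < b) :
    dist (y s) c ≤ ε := by
  refine le_of_tendsto ((hy s).dist tendsto_const_nhds) ?_
  filter_upwards [self_mem_nhdsWithin, mem_nhdsWithin_of_mem_nhds (Iio_mem_nhds h2)] with q hq hq2
  exact (h q hq.1 (h1.trans_lt hq.2) hq2).le

/-- The right limits along the dyadic numbers form a càdlàg path. -/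
theorem isCadlagPath_of_tendsto {y : ℝ≥0 → E}
    (hy : ∀ t, Tendsto x (𝓝[dyadics ∩ Set.Ioi t] t) (𝓝 (y t)))
    (hl : ∀ t, ∃ l, Tendsto x (𝓝[dyadics ∩ Set.Iio t] t) (𝓝 l)) : IsCadlagPath y := by
  intro t
  constructor
  · rw [Metric.continuousWithinAt_iff]
    intro ε hε
    obtain ⟨δ, hδ, h⟩ := Metric.tendsto_nhdsWithin_nhds.1 (hy t) (ε / 2) (by positivity)
    refine ⟨δ, hδ, fun {s} hs hsd => ?_⟩
    lift δ to ℝ≥0 using hδ.le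
    have hs2 : s < t + δ := by
      rw [NNReal.dist_eq] at hsd
      have := (abs_lt.1 hsd).2
      rw [← NNReal.coe_lt_coe]
      push_cast
      linarith
    refine (dist_le_of_tendsto_right hy (a := t) (b := t + δ) (fun q hq h1 h2 => h ⟨hq, h1⟩ ?_)
      hs hs2).trans_lt (by linarith)
    rw [NNReal.dist_eq, abs_lt]
    rw [← NNReal.coe_lt_coe] at h1 h2
    push_cast at h2
    constructor <;> linarith
  · obtain ⟨l, hl⟩ := hl t
    refine ⟨l, ?_⟩
    rw [Metric.tendsto_nhdsWithin_nhds]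
    intro ε hε
    obtain ⟨δ, hδ, h⟩ := Metric.tendsto_nhdsWithin_nhds.1 hl (ε / 2) (by positivity)
    refine ⟨δ, hδ, fun {s} hs hsd => ?_⟩
    refine (dist_le_of_tendsto_right hy (a := s) (b := t) (fun q hq h1 h2 => h ⟨hq, h2⟩ ?_)
      le_rfl hs).trans_lt (by linarith)
    rw [NNReal.dist_eq, abs_lt] at *
    rw [← NNReal.coe_lt_coe] at h1 h2
    constructor <;> linarith [hsd.1]

end Paths

/-! ### Existence of Lévy processes -/

section Levy

theorem tendsto_charFun_map {F Ω : Type} [NormedAddCommGroup F] [InnerProductSpace ℝ F]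
    [MeasurableSpace F] [BorelSpace F] [SecondCountableTopology F] {mΩ : MeasurableSpace Ω}
    {P : Measure Ω} [IsFiniteMeasure P] {Z : ℕ → Ω → F} {Z' : Ω → F}
    (hZ : ∀ n, AEMeasurable (Z n) P) (hZ' : AEMeasurable Z' P)
    (h : ∀ᵐ ω ∂P, Tendsto (fun n => Z n ω) atTop (𝓝 (Z' ω))) (x : F) :
    Tendsto (fun n => charFun (P.map (Z n)) x) atTop (𝓝 (charFun (P.map Z') x)) := by
  have hc : Continuous fun y : F => Complex.exp (inner ℝ y x * Complex.I) := by fun_prop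
  have e : ∀ W : Ω → F, AEMeasurable W P →
      charFun (P.map W) x = ∫ ω, Complex.exp (inner ℝ (W ω) x * Complex.I) ∂P := fun W hW => by
    rw [charFun_apply, integral_map hW hc.aestronglyMeasurable]
  simp only [e _ (hZ _), e _ hZ']
  refine tendsto_integral_of_dominated_convergence (fun _ => 1)
    (fun n => hc.comp_aestronglyMeasurable (hZ n).aestronglyMeasurable) (integrable_const _)
    (fun n => ae_of_all _ fun ω => by rw [Complex.norm_exp_ofReal_mul_I]) ?_
  filter_upwards [h] with ω hω
  exact (hc.tendsto _).comp hω

variable {E : Type} [NormedAddCommGroup E] [InnerProductSpace ℝ E] [FiniteDimensional ℝ E]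
  [MeasurableSpace E] [BorelSpace E] {Ω : Type} {mΩ : MeasurableSpace Ω} {P : Measure Ω}
  {X Y : ℝ≥0 → Ω → E} {ψ : E → ℂ}

/-- A regularization of a dyadic process is measurable and approximated from the right. -/
theorem IsDyadicProcess.exists_regularization [IsProbabilityMeasure P]
    (h : IsDyadicProcess X P ψ) : ∃ Y : ℝ≥0 → Ω → E, (∀ t, Measurable (Y t)) ∧
      (∀ᵐ ω ∂P, IsCadlagPath fun t => Y t ω) ∧
      ∀ t, ∀ᵐ ω ∂P, Tendsto (fun m => X (dyadicAbove m t) ω) atTop (𝓝 (Y t ω)) := by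
  classical
  -- The bad paths are enclosed in a measurable null set on which `Y` is set to `0`, so that each `Y
  -- t` is measurable and not only almost everywhere so.
  obtain ⟨G, hGsub, hGm, hG0⟩ := exists_measurable_superset_of_null
    (ae_iff.1 h.ae_exists_not_osc)
  have hG : ∀ ω ∉ G, FinOsc fun t => X t ω := fun ω hω => by
    by_contra hcon
    exact hω (hGsub hcon)
  have hGae : ∀ᵐ ω ∂P, ω ∉ G := measure_eq_zero_iff_ae_notMem.1 hG0
  have hlim : ∀ ω, ∃ y : ℝ≥0 → E, (ω ∉ G → ∀ t,
      Tendsto (fun s => X s ω) (𝓝[dyadics ∩ Set.Ioi t] t) (𝓝 (y t))) ∧ (ω ∈ G → y = 0) := by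
    intro ω
    by_cases hω : ω ∈ G
    · exact ⟨0, fun h => absurd hω h, fun _ => rfl⟩
    · choose y hy using (hG ω hω).exists_tendsto_right
      exact ⟨y, fun _ => hy, fun h => absurd h hω⟩
  choose y hy hy0 using hlim
  refine ⟨fun t ω => y ω t, fun t => ?_, ?_, fun t => ?_⟩
  · refine measurable_of_tendsto_metrizable
      (f := fun m => Gᶜ.indicator (X (dyadicAbove m t)))
      (fun m => (h.measurable _).indicator hGm.compl) ?_
    rw [tendsto_pi_nhds]
    intro ω
    by_cases hω : ω ∈ G
    · simp [hω, hy0 ω hω]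
    · simpa [hω, Function.comp_def] using (hy ω hω t).comp (tendsto_dyadicAbove t)
  · filter_upwards [hGae] with ω hω
    exact isCadlagPath_of_tendsto (hy ω hω) (hG ω hω).exists_tendsto_left
  · filter_upwards [hGae] with ω hω
    exact (hy ω hω t).comp (tendsto_dyadicAbove t)

theorem floor_mono (m : ℕ) {s t : ℝ≥0} (hst : s ≤ t) :
    ⌊s * 2 ^ m⌋₊ + 1 ≤ ⌊t * 2 ^ m⌋₊ + 1 := by
  gcongr

/-- Convergence of the exponents identifies the limiting characteristic function; continuity of `φ'`
is what makes `φ'` its distinguished logarithm. -/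
theorem isLogChar_of_tendsto [IsProbabilityMeasure P] {Z : ℕ → Ω → E} {Z' : Ω → E}
    (hZ : ∀ n, AEMeasurable (Z n) P) (hZ' : AEMeasurable Z' P)
    (h : ∀ᵐ ω ∂P, Tendsto (fun n => Z n ω) atTop (𝓝 (Z' ω))) {φ : ℕ → E → ℂ} {φ' : E → ℂ}
    (hφ : ∀ n, IsLogChar (P.map (Z n)) (φ n)) (hφ' : Continuous φ')
    (hlim : ∀ x, Tendsto (fun n => φ n x) atTop (𝓝 (φ' x))) : IsLogChar (P.map Z') φ' := by
  refine ⟨Measure.isProbabilityMeasure_map hZ', hφ', ?_, fun x => ?_⟩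
  · refine tendsto_nhds_unique (hlim 0) ?_
    simp [(hφ _).zero]
  · refine tendsto_nhds_unique (tendsto_charFun_map hZ hZ' h x) ?_
    simp only [(hφ _).exp_eq]
    exact (Complex.continuous_exp.tendsto _).comp (hlim x)

theorem IsDyadicProcess.isLogChar_sub [IsProbabilityMeasure P] (h : IsDyadicProcess X P ψ)
    (hψ : Continuous ψ) (hY : ∀ t, Measurable (Y t))
    (hlim : ∀ t, ∀ᵐ ω ∂P, Tendsto (fun m => X (dyadicAbove m t) ω) atTop (𝓝 (Y t ω)))
    {s t : ℝ≥0} (hst : s ≤ t) :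
    IsLogChar (P.map fun ω => Y t ω - Y s ω) (fun x => ((t - s : ℝ) : ℂ) * ψ x) := by
  refine isLogChar_of_tendsto (Z := fun m ω => X (dyadicAbove m t) ω - X (dyadicAbove m s) ω)
    (fun m => ((h.measurable _).sub (h.measurable _)).aemeasurable)
    ((hY t).sub (hY s)).aemeasurable ?_ (fun m => h.law_sub (floor_mono m hst)) (by fun_prop)
    fun x => ?_
  · filter_upwards [hlim s, hlim t] with ω h1 h2
    exact h2.sub h1
  · refine Tendsto.mul_const _ ((Complex.continuous_ofReal.tendsto _).comp ?_)
    have := ((NNReal.continuous_coe.tendsto _).comp (tendsto_dyadicAbove_nhds t)).sub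
      ((NNReal.continuous_coe.tendsto _).comp (tendsto_dyadicAbove_nhds s))
    refine this.congr fun m => ?_
    simp only [Function.comp, dyadicAbove]
    rw [Nat.cast_sub (floor_mono m hst)]
    push_cast
    ring

theorem IsDyadicProcess.isLogChar [IsProbabilityMeasure P] (h : IsDyadicProcess X P ψ)
    (hψ : Continuous ψ) (hY : ∀ t, Measurable (Y t))
    (hlim : ∀ t, ∀ᵐ ω ∂P, Tendsto (fun m => X (dyadicAbove m t) ω) atTop (𝓝 (Y t ω)))
    (t : ℝ≥0) : IsLogChar (P.map (Y t)) (fun x => ((t : ℝ) : ℂ) * ψ x) := by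
  refine isLogChar_of_tendsto
    (Z := fun m ω => X (dyadicAbove m t) ω - X (((0 : ℕ) : ℝ≥0) / 2 ^ m) ω)
    (fun m => ((h.measurable _).sub (h.measurable _)).aemeasurable)
    (hY t).aemeasurable ?_ (fun m => h.law_sub (Nat.zero_le _)) (by fun_prop) fun x => ?_
  · filter_upwards [hlim t, h.zero] with ω h1 h2
    simpa [h2] using h1
  · refine Tendsto.mul_const _ ((Complex.continuous_ofReal.tendsto _).comp ?_)
    refine ((NNReal.continuous_coe.tendsto _).comp (tendsto_dyadicAbove_nhds t)).congr fun m => ?_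
    simp [dyadicAbove]

/-- Increments between the dyadic points just above the `t i` are sums over disjoint blocks.
Independence is a factorization of the joint characteristic function, which passes to almost sure
limits. -/
theorem IsDyadicProcess.hasIndepIncrements [IsProbabilityMeasure P] (h : IsDyadicProcess X P ψ)
    (hY : ∀ t, Measurable (Y t))
    (hlim : ∀ t, ∀ᵐ ω ∂P, Tendsto (fun m => X (dyadicAbove m t) ω) atTop (𝓝 (Y t ω))) :
    HasIndepIncrements Y P := by
  intro n t ht
  let Z : ℕ → Fin n → Ω → E := fun m i ω =>
    X (dyadicAbove m (t i.succ)) ω - X (dyadicAbove m (t i.castSucc)) ω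
  have hZ : ∀ m i, Measurable (Z m i) := fun m i => (h.measurable _).sub (h.measurable _)
  have hW : ∀ i : Fin n, Measurable fun ω => Y (t i.succ) ω - Y (t i.castSucc) ω := fun i =>
    (hY _).sub (hY _)
  have hZi : ∀ m, iIndepFun (Z m) P := by
    intro m
    have hb := iIndepFun_sum_blocks (fun k => (h.measurable _).sub (h.measurable _)) (h.indep m)
      (s := fun i : Fin n => Finset.Ico (⌊t i.castSucc * 2 ^ m⌋₊ + 1) (⌊t i.succ * 2 ^ m⌋₊ + 1))
      (fun i j hij => by
        wlog hlt : i < j generalizing i j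
        · exact (this j i hij.symm (lt_of_le_of_ne (not_lt.1 hlt) hij.symm)).symm
        rw [Function.onFun, Finset.disjoint_left]
        intro a ha hb
        simp only [Finset.mem_Ico] at ha hb
        have := floor_mono m (ht (show i.succ ≤ j.castSucc from by
          rw [Fin.le_def]; simpa using hlt))
        omega)
    convert hb using 2 with i
    ext ω
    have hs := Finset.sum_Ico_sub (fun k : ℕ => X ((k : ℝ≥0) / 2 ^ m) ω)
      (floor_mono m (ht (Fin.castSucc_le_succ i)))
    exact hs.symm
  have hlimW : ∀ i : Fin n, ∀ᵐ ω ∂P,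
      Tendsto (fun m => Z m i ω) atTop (𝓝 (Y (t i.succ) ω - Y (t i.castSucc) ω)) := fun i => by
    filter_upwards [hlim (t i.succ), hlim (t i.castSucc)] with ω h1 h2
    exact h1.sub h2
  have hmLp : Continuous (WithLp.toLp 2 : (Fin n → E) → PiLp 2 fun _ : Fin n => E) :=
    PiLp.continuous_toLp 2 _
  rw [iIndepFun_iff_charFun_pi fun i => (hW i).aemeasurable]
  intro u
  refine tendsto_nhds_unique
    (tendsto_charFun_map (Z := fun m ω => WithLp.toLp 2 fun i => Z m i ω)
      (fun m => (hmLp.measurable.comp (measurable_pi_lambda _ fun i => hZ m i)).aemeasurable)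
      (hmLp.measurable.comp (measurable_pi_lambda _ fun i => hW i)).aemeasurable ?_ u) ?_
  · filter_upwards [ae_all_iff.2 hlimW] with ω hω
    exact (hmLp.tendsto _).comp (tendsto_pi_nhds.2 hω)
  · simp only [fun m => (iIndepFun_iff_charFun_pi fun i => (hZ m i).aemeasurable).1 (hZi m) u]
    exact tendsto_finsetProd _ fun i _ => tendsto_charFun_map
      (fun m => (hZ m i).aemeasurable) (hW i).aemeasurable (hlimW i) (u i)

/-- Every infinitely divisible law is the law at time `1` of a Lévy process. -/
theorem exists_isLevyProcess {ν : Measure E} (hν : ν ∈ ID E) :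
    ∃ (Ω : Type) (_ : MeasurableSpace Ω) (P : Measure Ω) (Y : ℝ≥0 → Ω → E),
      IsProbabilityMeasure P ∧ IsLevyProcess Y P ∧ HasLaw (Y 1) ν P := by
  obtain ⟨ψ, hψ⟩ := exists_isLogChar hν
  obtain ⟨Ω, mΩ, P, X, hP, hX⟩ := exists_isDyadicProcess hν hψ
  obtain ⟨Y, hY, hc, hlim⟩ := hX.exists_regularization
  have hlaw := fun t => hX.isLogChar hψ.cont hY hlim t
  refine ⟨Ω, mΩ, P, Y, hP, ⟨hY, hX.hasIndepIncrements hY hlim, fun s t => ?_, ?_, hc⟩,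
    (hY 1).aemeasurable, ?_⟩
  · refine IsLogChar.measure_eq (hX.isLogChar_sub hψ.cont hY hlim (le_self_add)) ?_
    convert hlaw t using 3
    simp
  · have h0 : P.map (Y 0) = Measure.dirac 0 := by
      refine (hlaw 0).measure_eq ⟨inferInstance, (hlaw 0).cont, by simp, fun x => ?_⟩
      simp [charFun_dirac]
    have h1 : ∀ᵐ z ∂(P.map (Y 0)), z = 0 := by
      rw [h0]
      exact (ae_dirac_iff (p := fun z : E => z = 0) (measurableSet_singleton 0)).2 rfl
    exact ae_of_ae_map (hY 0).aemeasurable h1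
  · refine IsLogChar.measure_eq (hlaw 1) ?_
    simpa using hψ

end Levy

/-! ### Existence of the pathwise integral -/

section Stieltjes

variable {E : Type} [NormedAddCommGroup E] [NormedSpace ℝ E]

/-- A tagged partition of `[0, 1]` of mesh less than `δ`. -/
structure IsTaggedPartition (δ : ℝ) (n : ℕ) (t τ : ℕ → ℝ≥0) : Prop where
  zero : t 0 = 0
  one : t n = 1
  tag : ∀ i < n, t i ≤ τ i ∧ τ i ≤ t (i + 1) ∧ (t (i + 1) : ℝ) - (t i : ℝ) < δ

/-- The Riemann–Stieltjes sum of a tagged partition. -/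
noncomputable def stieltjesSum (f : ℝ → ℝ) (y : ℝ≥0 → E) (n : ℕ) (t τ : ℕ → ℝ≥0) : E :=
  ∑ i ∈ Finset.range n, f (τ i) • (y (t (i + 1)) - y (t i))

theorem hasStieltjesIntegral_iff {f : ℝ → ℝ} {y : ℝ≥0 → E} {z : E} :
    HasStieltjesIntegral f y z ↔ ∀ ε : ℝ, 0 < ε → ∃ δ : ℝ, 0 < δ ∧ ∀ n t τ,
      IsTaggedPartition δ n t τ → ‖stieltjesSum f y n t τ - z‖ < ε := by
  refine forall₂_congr fun ε _ => exists_congr fun δ => and_congr_right fun _ => ?_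
  exact ⟨fun h n t τ hp => h n t τ hp.zero hp.one hp.tag, fun h n t τ h0 h1 h2 =>
    h n t τ ⟨h0, h1, h2⟩⟩

section Partition

variable {δ : ℝ} {n : ℕ} {t τ : ℕ → ℝ≥0}

theorem IsTaggedPartition.mono {δ' : ℝ} (h : IsTaggedPartition δ n t τ) (hδ : δ ≤ δ') :
    IsTaggedPartition δ' n t τ :=
  ⟨h.zero, h.one, fun i hi => ⟨(h.tag i hi).1, (h.tag i hi).2.1, (h.tag i hi).2.2.trans_le hδ⟩⟩

theorem IsTaggedPartition.le_of_le (h : IsTaggedPartition δ n t τ) {i j : ℕ} (hij : i ≤ j)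
    (hj : j ≤ n) : t i ≤ t j := by
  induction j, hij using Nat.le_induction with
  | base => exact le_rfl
  | succ j hij ih => exact (ih (by omega)).trans ((h.tag j hj).1.trans (h.tag j hj).2.1)

theorem IsTaggedPartition.le_one (h : IsTaggedPartition δ n t τ) {i : ℕ} (hi : i ≤ n) :
    t i ≤ 1 := by
  rw [← h.one]
  exact h.le_of_le hi le_rfl

theorem IsTaggedPartition.tag_mem (h : IsTaggedPartition δ n t τ) {i : ℕ} (hi : i < n) :
    (τ i : ℝ) ∈ Set.Icc (0 : ℝ) 1 :=
  ⟨(τ i).2, by exact_mod_cast (h.tag i hi).2.1.trans (h.le_one hi)⟩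

theorem IsTaggedPartition.pos (h : IsTaggedPartition δ n t τ) : 0 < n := by
  rcases Nat.eq_zero_or_pos n with rfl | hn
  · exact absurd (h.zero.symm.trans h.one) zero_ne_one
  · exact hn

/-- Summation by parts. -/
theorem IsTaggedPartition.norm_stieltjesSum_le (h : IsTaggedPartition δ n t τ) {f : ℝ → ℝ}
    (hf : MonotoneOn f (Set.Icc 0 1)) {M η : ℝ} (hM : ∀ s ∈ Set.Icc (0 : ℝ) 1, |f s| ≤ M)
    {u : ℝ≥0 → E} (hu : ∀ s ≤ 1, ‖u s‖ ≤ η) : ‖stieltjesSum f u n t τ‖ ≤ 4 * M * η := by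
  have hη : 0 ≤ η := (norm_nonneg _).trans (hu 0 zero_le)
  -- Abel summation with the boundary term removed: each step costs `f (τ k) - f (τ (k - 1))` times
  -- `η`, which telescopes. The truncation `0 - 1 = 0` covers `k = 0`. In total `3 M η`, plus `M η`
  -- for the boundary term.
  have key : ∀ k ≤ n, ‖∑ i ∈ Finset.range k, f (τ i) • (u (t (i + 1)) - u (t i))
      - f (τ (k - 1)) • u (t k)‖ ≤ (|f (τ 0)| + (f (τ (k - 1)) - f (τ 0))) * η := by
    intro k
    induction k with
    | zero =>
      intro _
      simp only [Finset.range_zero, Finset.sum_empty, zero_sub, norm_neg, Nat.zero_sub, sub_self,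
        add_zero, norm_smul, Real.norm_eq_abs]
      gcongr
      exact hu _ (h.le_one (Nat.zero_le _))
    | succ k ih =>
      intro hk
      have hmono : f (τ (k - 1)) ≤ f (τ k) := by
        rcases Nat.eq_zero_or_pos k with rfl | hk0
        · exact le_rfl
        · refine hf (h.tag_mem (by omega)) (h.tag_mem hk) ?_
          have h1 := (h.tag (k - 1) (by omega)).2.1
          rw [Nat.sub_add_cancel hk0] at h1
          exact_mod_cast h1.trans (h.tag k hk).1
      have e : ∑ i ∈ Finset.range (k + 1), f (τ i) • (u (t (i + 1)) - u (t i))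
          - f (τ (k + 1 - 1)) • u (t (k + 1)) =
          (∑ i ∈ Finset.range k, f (τ i) • (u (t (i + 1)) - u (t i)) - f (τ (k - 1)) • u (t k))
            - (f (τ k) - f (τ (k - 1))) • u (t k) := by
        rw [Finset.sum_range_succ, Nat.add_sub_cancel, smul_sub, sub_smul]
        abel
      rw [e, Nat.add_sub_cancel]
      refine (norm_sub_le _ _).trans ?_
      have h2 : ‖(f (τ k) - f (τ (k - 1))) • u (t k)‖ ≤ (f (τ k) - f (τ (k - 1))) * η := by
        rw [norm_smul, Real.norm_of_nonneg (sub_nonneg.2 hmono)]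
        exact mul_le_mul_of_nonneg_left (hu _ (h.le_one (by omega))) (sub_nonneg.2 hmono)
      linarith [ih (by omega)]
  have hn := h.pos
  have h1 := key n le_rfl
  have h0 := hM _ (h.tag_mem hn)
  have h2 := hM _ (h.tag_mem (i := n - 1) (by omega))
  have h3 : ‖f (τ (n - 1)) • u (t n)‖ ≤ M * η := by
    rw [norm_smul, Real.norm_eq_abs]
    exact mul_le_mul h2 (hu _ (h.le_one le_rfl)) (norm_nonneg _) ((abs_nonneg _).trans h2)
  have h4 : |f (τ 0)| + (f (τ (n - 1)) - f (τ 0)) ≤ 3 * M := by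
    have := (abs_le.1 h0).1
    have := (abs_le.1 h2).2
    linarith
  have h5 := norm_le_norm_sub_add (stieltjesSum f u n t τ) (f (τ (n - 1)) • u (t n))
  have h6 := mul_le_mul_of_nonneg_right h4 hη
  unfold stieltjesSum at *
  linarith

end Partition

theorem stieltjesSum_sub (f : ℝ → ℝ) (y y' : ℝ≥0 → E) (n : ℕ) (t τ : ℕ → ℝ≥0) :
    stieltjesSum f (y - y') n t τ = stieltjesSum f y n t τ - stieltjesSum f y' n t τ := by
  rw [stieltjesSum, stieltjesSum, stieltjesSum, ← Finset.sum_sub_distrib]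
  refine Finset.sum_congr rfl fun i _ => ?_
  rw [← smul_sub, Pi.sub_apply, Pi.sub_apply]
  congr 1
  abel

theorem HasStieltjesIntegral.add {f : ℝ → ℝ} {y y' : ℝ≥0 → E} {z z' : E}
    (h : HasStieltjesIntegral f y z) (h' : HasStieltjesIntegral f y' z') :
    HasStieltjesIntegral f (y + y') (z + z') := by
  rw [hasStieltjesIntegral_iff] at *
  intro ε hε
  obtain ⟨δ, hδ, h⟩ := h (ε / 2) (by positivity)
  obtain ⟨δ', hδ', h'⟩ := h' (ε / 2) (by positivity)
  refine ⟨min δ δ', lt_min hδ hδ', fun n t τ hp => ?_⟩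
  have h1 := h n t τ (hp.mono (min_le_left _ _))
  have h2 := h' n t τ (hp.mono (min_le_right _ _))
  have e : stieltjesSum f (y + y') n t τ - (z + z') =
      (stieltjesSum f y n t τ - z) + (stieltjesSum f y' n t τ - z') := by
    have := stieltjesSum_sub f (y + y') y' n t τ
    rw [add_sub_cancel_right] at this
    rw [this]
    abel
  rw [e]
  exact (norm_add_le _ _).trans_lt (by linarith)

theorem HasStieltjesIntegral.neg {f : ℝ → ℝ} {y : ℝ≥0 → E} {z : E}
    (h : HasStieltjesIntegral f y z) : HasStieltjesIntegral (-f) y (-z) := by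
  rw [hasStieltjesIntegral_iff] at *
  intro ε hε
  obtain ⟨δ, hδ, h⟩ := h ε hε
  refine ⟨δ, hδ, fun n t τ hp => ?_⟩
  have e : stieltjesSum (-f) y n t τ - -z = -(stieltjesSum f y n t τ - z) := by
    simp only [stieltjesSum, Pi.neg_apply, neg_smul, Finset.sum_neg_distrib]
    abel
  rw [e, norm_neg]
  exact h n t τ hp

theorem hasStieltjesIntegral_indicator {f : ℝ → ℝ} (hf : ContinuousOn f (Set.Icc 0 1)) (s : ℝ≥0)
    (v : E) : ∃ z, HasStieltjesIntegral f (fun r => if s ≤ r then v else 0) z := by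
  set φ : ℝ≥0 → ℝ := fun r => if s ≤ r then 1 else 0 with hφ
  have hφm : Monotone φ := fun a b hab => by
    simp only [hφ]
    split_ifs with h1 h2
    · exact le_rfl
    · exact absurd (h1.trans hab) h2
    · exact zero_le_one
    · exact le_rfl
  have e : (fun r => if s ≤ r then v else 0) = fun r => φ r • v := by
    ext r
    by_cases h : s ≤ r <;> simp [hφ, h]
  rw [e]
  -- Only a subinterval with `t i < s ≤ t (i + 1)` contributes, and its tag is near `s`. The factor
  -- `φ 1 - φ 0` is `0` for `s = 0` and for `s > 1`.
  refine ⟨f s • ((φ 1 - φ 0) • v), ?_⟩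
  rw [hasStieltjesIntegral_iff]
  intro ε hε
  have hu := Metric.uniformContinuousOn_iff.1
    (isCompact_Icc.uniformContinuousOn_of_continuous hf) (ε / (‖v‖ + 1)) (by positivity)
  obtain ⟨δ, hδ, hu⟩ := hu
  refine ⟨δ, hδ, fun n t τ hp => ?_⟩
  have htel : ∑ i ∈ Finset.range n, (φ (t (i + 1)) - φ (t i)) = φ 1 - φ 0 := by
    rw [Finset.sum_range_sub (fun i => φ (t i)), hp.zero, hp.one]
  have e2 : stieltjesSum f (fun r => φ r • v) n t τ - f s • ((φ 1 - φ 0) • v) =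
      ∑ i ∈ Finset.range n, ((f (τ i) - f s) * (φ (t (i + 1)) - φ (t i))) • v := by
    rw [stieltjesSum, ← htel, Finset.sum_smul, Finset.smul_sum, ← Finset.sum_sub_distrib]
    refine Finset.sum_congr rfl fun i _ => ?_
    rw [← sub_smul, smul_smul, smul_smul, ← sub_smul, sub_mul]
  have hle : ∀ i ∈ Finset.range n, ‖((f (τ i) - f s) * (φ (t (i + 1)) - φ (t i))) • v‖ ≤
      (φ (t (i + 1)) - φ (t i)) * (ε / (‖v‖ + 1) * ‖v‖) := by
    intro i hi
    rw [Finset.mem_range] at hi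
    have hd : 0 ≤ φ (t (i + 1)) - φ (t i) :=
      sub_nonneg.2 (hφm (hp.le_of_le (Nat.le_succ i) hi))
    rw [norm_smul, norm_mul, Real.norm_of_nonneg hd]
    by_cases hs : t i < s ∧ s ≤ t (i + 1)
    · have h1 := hp.tag i hi
      have h2 : ‖f (τ i) - f s‖ ≤ ε / (‖v‖ + 1) := by
        rw [← dist_eq_norm]
        refine (hu _ (hp.tag_mem hi) s ⟨s.coe_nonneg, ?_⟩ ?_).le
        · exact_mod_cast hs.2.trans (hp.le_one hi)
        · rw [Real.dist_eq, abs_lt]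
          have h3 : (t i : ℝ) ≤ τ i := by exact_mod_cast h1.1
          have h4 : (τ i : ℝ) ≤ t (i + 1) := by exact_mod_cast h1.2.1
          have h5 : (t i : ℝ) < s := by exact_mod_cast hs.1
          have h6 : (s : ℝ) ≤ t (i + 1) := by exact_mod_cast hs.2
          have h7 := h1.2.2
          constructor <;> linarith
      rw [mul_comm ‖f (τ i) - f s‖, mul_assoc]
      gcongr
    · have : φ (t (i + 1)) - φ (t i) = 0 := by
        simp only [hφ]
        by_cases h1 : s ≤ t i
        · simp [h1, h1.trans (hp.le_of_le (Nat.le_succ i) hi)]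
        · simp [h1, not_le.1 fun h2 => hs ⟨not_le.1 h1, h2⟩]
      simp [this]
  rw [e2]
  refine (norm_sum_le_of_le _ hle).trans_lt ?_
  rw [← Finset.sum_mul, htel]
  have h1 : φ 1 - φ 0 ≤ 1 := by
    simp only [hφ]
    split_ifs <;> norm_num
  have h2 : ε / (‖v‖ + 1) * ‖v‖ < ε := by
    rw [div_mul_eq_mul_div, div_lt_iff₀ (by positivity)]
    nlinarith [norm_nonneg v]
  have h3 : 0 ≤ ε / (‖v‖ + 1) * ‖v‖ := by positivity
  nlinarith

/-- Right-continuous step functions. -/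
inductive IsStep : (ℝ≥0 → E) → Prop
  | zero : IsStep 0
  | add_indicator (y : ℝ≥0 → E) (s : ℝ≥0) (v : E) : IsStep y →
      IsStep (y + fun r => if s ≤ r then v else 0)

theorem IsStep.exists_hasStieltjesIntegral {f : ℝ → ℝ} (hf : ContinuousOn f (Set.Icc 0 1))
    {y : ℝ≥0 → E} (hy : IsStep y) : ∃ z, HasStieltjesIntegral f y z := by
  induction hy with
  | zero =>
    refine ⟨0, fun ε hε => ⟨1, one_pos, fun n t τ _ _ _ => by simpa using hε⟩⟩
  | add_indicator y s v _ ih =>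
    obtain ⟨z, hz⟩ := ih
    obtain ⟨z', hz'⟩ := hasStieltjesIntegral_indicator hf s v
    exact ⟨_, hz.add hz'⟩

/-- Càdlàg paths are uniformly approximated by step functions on compact intervals. -/
theorem IsCadlagPath.exists_isStep {y : ℝ≥0 → E} (hy : IsCadlagPath y) {η : ℝ} (hη : 0 < η) :
    ∃ y' : ℝ≥0 → E, IsStep y' ∧ ∀ s ≤ 1, ‖(y - y') s‖ ≤ η := by
  -- `S` collects the `T` up to which an approximation exists that is constant from `T` on. Were the
  -- supremum finite, the left limit would lead up to it and right continuity past it.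
  let S : Set ℝ≥0 := {T | ∃ (y' : ℝ≥0 → E) (c : E), IsStep y' ∧ (∀ r < T, ‖y r - y' r‖ ≤ η) ∧
    ∀ r, T ≤ r → y' r = c}
  have h0 : (0 : ℝ≥0) ∈ S := ⟨0, 0, IsStep.zero, fun r hr => absurd hr not_lt_zero, fun r _ => rfl⟩
  by_cases hb : BddAbove S
  · exfalso
    set T := sSup S with hT
    obtain ⟨hr, l, hl⟩ := hy T
    obtain ⟨δ, hδ, hr⟩ := Metric.continuousWithinAt_iff.1 hr η hη
    have hT' : ∃ T' ∈ S, T' ≤ T ∧ ∀ r, T' ≤ r → r < T → ‖y r - l‖ ≤ η := by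
      obtain ⟨δ', hδ', hl⟩ := Metric.tendsto_nhdsWithin_nhds.1 hl η hη
      have hT'' : ∃ T' ∈ S, (T : ℝ) - δ' < T' := by
        by_contra! hcon
        lift δ' to ℝ≥0 using hδ'.le
        have hδ'' : 0 < δ' := by exact_mod_cast hδ'
        have hTd : (δ' : ℝ) ≤ T := by
          have h2 := hcon 0 h0
          rw [NNReal.coe_zero] at h2
          linarith
        have h3 : T ≤ T - δ' := csSup_le ⟨0, h0⟩ fun b hb => by
          rw [← NNReal.coe_le_coe, NNReal.coe_sub (by exact_mod_cast hTd)]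
          exact hcon b hb
        have h4 : T - δ' < T := tsub_lt_self (lt_of_lt_of_le hδ'' (by exact_mod_cast hTd)) hδ''
        exact absurd h3 (not_le.2 h4)
      obtain ⟨T', h1, h2⟩ := hT''
      refine ⟨T', h1, le_csSup hb h1, fun r hr1 hr2 => ?_⟩
      rw [← dist_eq_norm]
      refine (hl hr2 ?_).le
      rw [NNReal.dist_eq, abs_lt]
      rw [← NNReal.coe_le_coe] at hr1
      rw [← NNReal.coe_lt_coe] at hr2
      constructor <;> linarith
    obtain ⟨T', ⟨y', c, h1, h2, h3⟩, h4, h5⟩ := hT'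
    lift δ to ℝ≥0 using hδ.le
    have hmem : T + δ ∈ S := by
      refine ⟨_, y T, (h1.add_indicator _ T' (l - c)).add_indicator _ T (y T - l),
        fun r hr' => ?_, fun r hr' => ?_⟩
      · rcases lt_or_ge r T' with h6 | h6
        · simpa [not_le.2 h6, not_le.2 (h6.trans_le h4)] using h2 r h6
        · rcases lt_or_ge r T with h7 | h7
          · simpa [h6, not_le.2 h7, h3 r h6] using h5 r h6 h7
          · have := hr (x := r) h7 (by
              rw [NNReal.dist_eq, abs_lt]
              rw [← NNReal.coe_lt_coe] at hr'
              rw [← NNReal.coe_le_coe] at h7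
              push_cast at hr'
              constructor <;> linarith)
            rw [dist_eq_norm] at this
            simpa [h6, h7, h3 r h6] using this.le
      · have h7 : T ≤ r := le_self_add.trans hr'
        have h6 : T' ≤ r := h4.trans h7
        simp [h6, h7, h3 r h6]
    have : T + δ ≤ T := le_csSup hb hmem
    have hδ' : 0 < δ := by exact_mod_cast hδ
    exact absurd this (not_le.2 (lt_add_of_pos_right T hδ'))
  · rw [not_bddAbove_iff] at hb
    obtain ⟨T, ⟨y', c, h1, h2, -⟩, h3⟩ := hb 1
    exact ⟨y', h1, fun s hs => h2 s (hs.trans_lt h3)⟩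

/-- The Riemann–Stieltjes sum over the uniform grid. -/
noncomputable def gridSum (f : ℝ → ℝ) (y : ℝ≥0 → E) (n : ℕ) : E :=
  stieltjesSum f y n (fun i => (i : ℝ≥0) / n) (fun i => (i : ℝ≥0) / n)

theorem isTaggedPartition_grid {δ : ℝ} {n : ℕ} (hn : n ≠ 0) (h : 1 / (n : ℝ) < δ) :
    IsTaggedPartition δ n (fun i => (i : ℝ≥0) / n) (fun i => (i : ℝ≥0) / n) := by
  have hn' : (n : ℝ≥0) ≠ 0 := by exact_mod_cast hn
  refine ⟨by simp, div_self hn', fun i _ => ⟨le_rfl, ?_, ?_⟩⟩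
  · gcongr
    simp
  · push_cast
    rw [← sub_div]
    simpa using h

theorem eventually_isTaggedPartition_grid {δ : ℝ} (hδ : 0 < δ) : ∀ᶠ n : ℕ in atTop,
    IsTaggedPartition δ n (fun i => (i : ℝ≥0) / n) (fun i => (i : ℝ≥0) / n) := by
  filter_upwards [eventually_ne_atTop 0,
    (tendsto_one_div_atTop_nhds_zero_nat (𝕜 := ℝ)).eventually_lt_const hδ] with n h1 h2
  exact isTaggedPartition_grid h1 h2

theorem HasStieltjesIntegral.tendsto_gridSum {f : ℝ → ℝ} {y : ℝ≥0 → E} {z : E}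
    (h : HasStieltjesIntegral f y z) : Tendsto (gridSum f y) atTop (𝓝 z) := by
  rw [hasStieltjesIntegral_iff] at h
  rw [Metric.tendsto_nhds]
  intro ε hε
  obtain ⟨δ, hδ, h⟩ := h ε hε
  filter_upwards [eventually_isTaggedPartition_grid hδ] with n hn
  rw [dist_eq_norm]
  exact h n _ _ hn

/-- Replacing the path by a uniformly close step function changes all Riemann–Stieltjes sums by at
most `4 M η`, whatever the partition. Hence the sums are Cauchy as the mesh shrinks, and the limit
can be read off uniform grids. -/
theorem exists_hasStieltjesIntegral_of_monotoneOn [CompleteSpace E] {f : ℝ → ℝ}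
    (hf : ContinuousOn f (Set.Icc 0 1)) (hm : MonotoneOn f (Set.Icc 0 1)) {y : ℝ≥0 → E}
    (hy : IsCadlagPath y) : ∃ z, HasStieltjesIntegral f y z := by
  obtain ⟨M, hM⟩ := isCompact_Icc.exists_bound_of_continuousOn hf
  have hM0 : 0 ≤ M := (norm_nonneg _).trans (hM 0 (by simp))
  have key : ∀ ε : ℝ, 0 < ε → ∃ z', ∃ δ : ℝ, 0 < δ ∧ ∀ n t τ, IsTaggedPartition δ n t τ →
      ‖stieltjesSum f y n t τ - z'‖ < ε := by
    intro ε hε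
    obtain ⟨y', h1, h2⟩ := hy.exists_isStep (η := ε / (2 * (4 * M + 1))) (by positivity)
    obtain ⟨z', hz'⟩ := h1.exists_hasStieltjesIntegral hf
    obtain ⟨δ, hδ, h3⟩ := hasStieltjesIntegral_iff.1 hz' (ε / 2) (by positivity)
    refine ⟨z', δ, hδ, fun n t τ hp => ?_⟩
    have h4 := hp.norm_stieltjesSum_le hm hM h2
    rw [stieltjesSum_sub] at h4
    have h5 := norm_sub_le_norm_sub_add_norm_sub (stieltjesSum f y n t τ)
      (stieltjesSum f y' n t τ) z'
    have h6 : 4 * M * (ε / (2 * (4 * M + 1))) ≤ ε / 2 := by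
      rw [mul_div_assoc', div_le_div_iff₀ (by positivity) (by positivity)]
      nlinarith
    linarith [h3 n t τ hp]
  have hc : CauchySeq (gridSum f y) := by
    rw [Metric.cauchySeq_iff']
    intro ε hε
    obtain ⟨z', δ, hδ, h⟩ := key (ε / 2) (by positivity)
    obtain ⟨N, hN⟩ := eventually_atTop.1 (eventually_isTaggedPartition_grid hδ)
    refine ⟨N, fun n hn => ?_⟩
    have h1 := h n _ _ (hN n hn)
    have h2 := h N _ _ (hN N le_rfl)
    rw [← dist_eq_norm] at h1 h2
    exact (dist_triangle_right _ _ z').trans_lt (by unfold gridSum; linarith)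
  obtain ⟨z, hz⟩ := cauchySeq_tendsto_of_complete hc
  refine ⟨z, hasStieltjesIntegral_iff.2 fun ε hε => ?_⟩
  obtain ⟨z', δ, hδ, h⟩ := key (ε / 2) (by positivity)
  refine ⟨δ, hδ, fun n t τ hp => ?_⟩
  have h1 : ‖z - z'‖ ≤ ε / 2 := by
    refine le_of_tendsto (hz.sub_const z').norm ?_
    filter_upwards [eventually_isTaggedPartition_grid hδ] with n hn
    exact (h n _ _ hn).le
  have h2 := norm_sub_le_norm_sub_add_norm_sub (stieltjesSum f y n t τ) z' z
  rw [norm_sub_rev z' z] at h2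
  linarith [h n t τ hp]

theorem exists_hasStieltjesIntegral [CompleteSpace E] {f : ℝ → ℝ}
    (hf : ContinuousOn f (Set.Icc 0 1))
    (hm : MonotoneOn f (Set.Icc 0 1) ∨ AntitoneOn f (Set.Icc 0 1)) {y : ℝ≥0 → E}
    (hy : IsCadlagPath y) : ∃ z, HasStieltjesIntegral f y z := by
  rcases hm with hm | hm
  · exact exists_hasStieltjesIntegral_of_monotoneOn hf hm hy
  · obtain ⟨z, hz⟩ := exists_hasStieltjesIntegral_of_monotoneOn hf.neg hm.neg hy
    have := hz.neg
    rw [neg_neg] at this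
    exact ⟨-z, this⟩

end Stieltjes

/-! ### The law of the random integral -/

section Law

theorem tendsto_riemannSum {g : ℝ → ℂ} (hg : Continuous g) :
    Tendsto (fun n : ℕ => ∑ i ∈ Finset.range (n + 1), g ((i : ℝ) / ((n + 1 : ℕ) : ℝ)) / ((n + 1 : ℕ) : ℂ))
      atTop (𝓝 (∫ t in (0 : ℝ)..1, g t)) := by
  rw [Metric.tendsto_nhds]
  intro ε hε
  obtain ⟨δ, hδ, hu⟩ := Metric.uniformContinuousOn_iff.1
    ((isCompact_Icc (a := (0 : ℝ)) (b := 1)).uniformContinuousOn_of_continuous hg.continuousOn)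
    (ε / 2) (by positivity)
  filter_upwards [(tendsto_one_div_add_atTop_nhds_zero_nat (𝕜 := ℝ)).eventually_lt_const hδ]
    with n hn
  set N : ℝ := ((n + 1 : ℕ) : ℝ) with hN
  have hNpos : 0 < N := by positivity
  have hn' : 1 / N < δ := by simpa [hN] using hn
  have hsum : ∫ t in (0 : ℝ)..1, g t =
      ∑ i ∈ Finset.range (n + 1), ∫ t in (i / N : ℝ)..((i + 1 : ℕ) / N : ℝ), g t := by
    rw [intervalIntegral.sum_integral_adjacent_intervals (a := fun i : ℕ => (i / N : ℝ))
      fun k _ => hg.intervalIntegrable _ _]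
    simp only [Nat.cast_zero, zero_div]
    rw [← hN, div_self hNpos.ne']
  have hterm : ∀ i ∈ Finset.range (n + 1),
      ‖g (i / N) / ((n + 1 : ℕ) : ℂ) - ∫ t in (i / N : ℝ)..((i + 1 : ℕ) / N : ℝ), g t‖
        ≤ ε / 2 * (1 / N) := by
    intro i hi
    rw [Finset.mem_range] at hi
    have hlen : ((i + 1 : ℕ) / N : ℝ) - i / N = 1 / N := by
      push_cast
      ring
    have hle : (i / N : ℝ) ≤ (i + 1 : ℕ) / N := by
      have : 0 < 1 / N := by positivity
      linarith
    have hc : g (i / N) / ((n + 1 : ℕ) : ℂ) =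
        ∫ t in (i / N : ℝ)..((i + 1 : ℕ) / N : ℝ), g (i / N) := by
      rw [intervalIntegral.integral_const, hlen, hN, Complex.real_smul]
      push_cast
      ring
    rw [hc, ← intervalIntegral.integral_sub (by simp) (hg.intervalIntegrable _ _)]
    refine (intervalIntegral.norm_integral_le_of_norm_le_const (C := ε / 2) fun t ht => ?_).trans
      (by rw [hlen, abs_of_pos (by positivity)])
    rw [Set.uIoc_of_le hle] at ht
    have h0 : (0 : ℝ) ≤ i / N := by positivity
    have h1 : ((i + 1 : ℕ) / N : ℝ) ≤ 1 := by
      rw [div_le_one hNpos, hN]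
      exact_mod_cast hi
    rw [← dist_eq_norm]
    refine (hu _ ⟨h0, hle.trans h1⟩ _ ⟨h0.trans ht.1.le, ht.2.trans h1⟩ ?_).le
    rw [Real.dist_eq, abs_lt]
    constructor <;> linarith [ht.1, ht.2]
  rw [hsum, dist_eq_norm, ← Finset.sum_sub_distrib]
  refine (norm_sum_le_of_le _ hterm).trans_lt ?_
  rw [Finset.sum_const, Finset.card_range, nsmul_eq_mul, ← hN]
  field_simp
  linarith

variable {E : Type} [NormedAddCommGroup E] [InnerProductSpace ℝ E] [FiniteDimensional ℝ E]
  [MeasurableSpace E] [BorelSpace E]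

theorem IsLogChar.map_smul {Ω : Type} {mΩ : MeasurableSpace Ω} {P : Measure Ω} {ξ : Ω → E}
    {ψ : E → ℂ} (hm : Measurable ξ) (h : IsLogChar (P.map ξ) ψ) (c : ℝ) :
    IsLogChar (P.map fun ω => c • ξ ω) (fun x => ψ (c • x)) := by
  have := h.prob
  have e : P.map (fun ω => c • ξ ω) = (P.map ξ).map fun y => c • y := by
    rw [Measure.map_map (by fun_prop) hm]
    rfl
  have hc := h.cont
  refine ⟨?_, by fun_prop, by simp [h.zero], fun x => ?_⟩
  · rw [e]
    exact Measure.isProbabilityMeasure_map (by fun_prop)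
  · rw [e, charFun_map_smul, h.exp_eq]

section ProcessLaw

variable {Ω : Type} {mΩ : MeasurableSpace Ω} {P : Measure Ω} {Y : ℝ≥0 → Ω → E} {ν : Measure E}
  {ψ : E → ℂ}

/-- The increments of a Lévy process over a uniform grid of `[0, 1]`. -/
theorem IsLevyProcess.isLogChar_increment [IsProbabilityMeasure P] (hY : IsLevyProcess Y P)
    (h1 : HasLaw (Y 1) ν P) (hψ : IsLogChar ν ψ) {n : ℕ} (hn : n ≠ 0) :
    iIndepFun (fun (i : ℕ) ω => Y (((i + 1 : ℕ) : ℝ≥0) / n) ω - Y ((i : ℝ≥0) / n) ω) P ∧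
    ∀ i : ℕ, IsLogChar (P.map fun ω => Y (((i + 1 : ℕ) : ℝ≥0) / n) ω - Y ((i : ℝ≥0) / n) ω)
      (fun x => ψ x / n) := by
  have hmono : Monotone fun i : ℕ => (i : ℝ≥0) / n := fun i j hij => by
    dsimp only
    gcongr
  have hi := hY.indep_increments.nat hmono
  have hm : ∀ i : ℕ, Measurable fun ω => Y (((i + 1 : ℕ) : ℝ≥0) / n) ω - Y ((i : ℝ≥0) / n) ω :=
    fun i => (hY.measurable _).sub (hY.measurable _)
  set κ : Measure E := P.map (Y (1 / n)) with hκ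
  have : IsProbabilityMeasure κ := Measure.isProbabilityMeasure_map (hY.measurable _).aemeasurable
  have hlaw : ∀ i : ℕ,
      P.map (fun ω => Y (((i + 1 : ℕ) : ℝ≥0) / n) ω - Y ((i : ℝ≥0) / n) ω) = κ := fun i => by
    rw [hκ, ← hY.stationary_increments ((i : ℝ≥0) / n) (1 / n), ← add_div]
    simp
  have hroot : convPow κ n = ν := by
    have := hψ.prob
    have := isProbabilityMeasure_convPow κ n
    refine Measure.ext_of_charFun (funext fun x => ?_)
    have hsum : Y 1 =ᵐ[P] fun ω => ∑ i ∈ Finset.range n,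
        (Y (((i + 1 : ℕ) : ℝ≥0) / n) ω - Y ((i : ℝ≥0) / n) ω) := by
      filter_upwards [hY.start_zero] with ω hω
      rw [Finset.sum_range_sub (fun i : ℕ => Y ((i : ℝ≥0) / n) ω)]
      simp [hω, hn]
    rw [charFun_convPow, ← h1.map_eq, Measure.map_congr hsum,
      iIndepFun.charFun_map_fun_finsetSum_eq_prod (fun i _ => (hm i).aemeasurable) (hi.restrict _),
      Finset.prod_apply]
    simp only [hlaw, Finset.prod_const, Finset.card_range]
  refine ⟨hi, fun i => ?_⟩
  rw [hlaw]
  exact hψ.of_convPow inferInstance hn hroot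

theorem gridSum_apply (f : ℝ → ℝ) (y : ℝ≥0 → E) (n : ℕ) : gridSum f y n =
    ∑ i ∈ Finset.range n, f ((i : ℝ) / n) • (y (((i + 1 : ℕ) : ℝ≥0) / n) - y ((i : ℝ≥0) / n)) := by
  simp [gridSum, stieltjesSum]

theorem IsLevyProcess.measurable_gridSum (hY : IsLevyProcess Y P) (f : ℝ → ℝ) (n : ℕ) :
    Measurable fun ω => gridSum f (fun t => Y t ω) n := by
  have := hY.measurable
  simp only [gridSum_apply]
  fun_prop

theorem IsLevyProcess.isLogChar_gridSum [IsProbabilityMeasure P] (hY : IsLevyProcess Y P)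
    (h1 : HasLaw (Y 1) ν P) (hψ : IsLogChar ν ψ) (f : ℝ → ℝ) {n : ℕ} (hn : n ≠ 0) :
    IsLogChar (P.map fun ω => gridSum f (fun t => Y t ω) n)
      (fun x => ∑ i ∈ Finset.range n, ψ (f ((i : ℝ) / n) • x) / n) := by
  obtain ⟨hi, hl⟩ := hY.isLogChar_increment h1 hψ hn
  have hm : ∀ i : ℕ, Measurable fun ω => Y (((i + 1 : ℕ) : ℝ≥0) / n) ω - Y ((i : ℝ≥0) / n) ω :=
    fun i => (hY.measurable _).sub (hY.measurable _)
  simp only [gridSum_apply]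
  exact IsLogChar.map_sum (ψ := fun (i : ℕ) x => ψ (f ((i : ℝ) / n) • x) / n)
    (fun i => (hm i).const_smul _)
    (hi.comp (fun i v => f ((i : ℝ) / n) • v) fun i => measurable_const_smul _)
    (fun i => (hl i).map_smul (hm i) _) _

end ProcessLaw

/-- The logarithm of the characteristic function of `∫_0^1 f(t) dY(t)`. -/
noncomputable def integralLog (f : ℝ → ℝ) (ψ : E → ℂ) (x : E) : ℂ := ∫ t in (0 : ℝ)..1, ψ (f t • x)

theorem continuous_integralLog {f : ℝ → ℝ} (hf : Continuous f) {ψ : E → ℂ} (hψ : Continuous ψ) :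
    Continuous (integralLog f ψ) :=
  intervalIntegral.continuous_parametric_intervalIntegral_of_continuous' (by fun_prop) 0 1

theorem IsRandomIntegralLaw.isLogChar {f : ℝ → ℝ} (hf : Continuous f) {ν μ : Measure E}
    {ψ : E → ℂ} (hψ : IsLogChar ν ψ) (h : IsRandomIntegralLaw f ν μ) :
    IsLogChar μ (integralLog f ψ) := by
  obtain ⟨Ω, mΩ, P, Y, Z, hP, hY, h1, hZ, hμ⟩ := h
  rw [← hμ.map_eq]
  have hc := hψ.cont
  refine isLogChar_of_tendsto (Z := fun n ω => gridSum f (fun t => Y t ω) (n + 1))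
    (fun n => (hY.measurable_gridSum f _).aemeasurable) hμ.aemeasurable ?_
    (fun n => hY.isLogChar_gridSum h1 hψ f n.succ_ne_zero) (continuous_integralLog hf hc)
    fun x => tendsto_riemannSum (g := fun t => ψ (f t • x)) (by fun_prop)
  filter_upwards [hZ] with ω hω
  exact hω.tendsto_gridSum.comp (tendsto_add_atTop_nat 1)

theorem exists_isRandomIntegralLaw {f : ℝ → ℝ} (hf : Continuous f)
    (hm : MonotoneOn f (Set.Icc 0 1) ∨ AntitoneOn f (Set.Icc 0 1)) {ν : Measure E}
    (hν : ν ∈ ID E) : ∃ μ, IsRandomIntegralLaw f ν μ := by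
  obtain ⟨Ω, mΩ, P, Y, hP, hY, h1⟩ := exists_isLevyProcess hν
  have hex : ∀ ω, ∃ z : E, IsCadlagPath (fun t => Y t ω) →
      HasStieltjesIntegral f (fun t => Y t ω) z := fun ω => by
    by_cases hω : IsCadlagPath fun t => Y t ω
    · obtain ⟨z, hz⟩ := exists_hasStieltjesIntegral hf.continuousOn hm hω
      exact ⟨z, fun _ => hz⟩
    · exact ⟨0, fun h => absurd h hω⟩
  choose Z hZ using hex
  have hZ' : ∀ᵐ ω ∂P, HasStieltjesIntegral f (fun t => Y t ω) (Z ω) := by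
    filter_upwards [hY.cadlag] with ω hω using hZ ω hω
  -- `Z` was chosen path by path; measurability comes from its being an almost sure limit of grid
  -- sums.
  have hZm : AEMeasurable Z P := by
    refine aemeasurable_of_tendsto_metrizable_ae atTop
      (f := fun n ω => gridSum f (fun t => Y t ω) n)
      (fun n => (hY.measurable_gridSum f n).aemeasurable) ?_
    filter_upwards [hZ'] with ω hω using hω.tendsto_gridSum
  exact ⟨P.map Z, Ω, mΩ, P, Y, Z, hP, hY, h1, hZ', hZm, rfl⟩

/-- The random integral law is determined by its log-characteristic function. -/
theorem isRandomIntegralLaw_iff {f : ℝ → ℝ} (hf : Continuous f)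
    (hm : MonotoneOn f (Set.Icc 0 1) ∨ AntitoneOn f (Set.Icc 0 1)) {ν μ : Measure E}
    {ψ : E → ℂ} (hν : ν ∈ ID E) (hψ : IsLogChar ν ψ) :
    IsRandomIntegralLaw f ν μ ↔ IsLogChar μ (integralLog f ψ) := by
  refine ⟨fun h => h.isLogChar hf hψ, fun h => ?_⟩
  -- Some Lévy process realizes some integral law; that law has the same exponent as `μ`, so it is
  -- `μ`.
  obtain ⟨μ', hμ'⟩ := exists_isRandomIntegralLaw hf hm hν
  rwa [h.measure_eq (hμ'.isLogChar hf hψ)]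

theorem integralLog_const_mul (f : ℝ → ℝ) (c : ℂ) (ψ : E → ℂ) :
    integralLog f (fun x => c * ψ x) = fun x => c * integralLog f ψ x := by
  ext x
  exact intervalIntegral.integral_const_mul c _

theorem IsRandomIntegralLaw.mem_ID {f : ℝ → ℝ} (hf : Continuous f)
    (hm : MonotoneOn f (Set.Icc 0 1) ∨ AntitoneOn f (Set.Icc 0 1)) {ν μ : Measure E}
    (hν : ν ∈ ID E) (h : IsRandomIntegralLaw f ν μ) : μ ∈ ID E := by
  obtain ⟨ψ, hψ⟩ := exists_isLogChar hν
  have hμ := h.isLogChar hf hψ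
  refine ⟨hμ.prob, fun n hn => ?_⟩
  have hn0 : (n : ℂ) ≠ 0 := by exact_mod_cast (by omega : n ≠ 0)
  obtain ⟨κ, hκ, hκψ⟩ := exists_root_mem_ID hν hψ (n := n) (by omega)
  obtain ⟨μ', hμ'⟩ := exists_isRandomIntegralLaw hf hm hκ
  have hl := hμ'.isLogChar hf hκψ
  refine ⟨μ', hl.prob, (hl.convPow n).measure_eq ?_⟩
  simp only [div_eq_inv_mul, integralLog_const_mul]
  convert hμ using 2 with x
  rw [← mul_assoc, mul_inv_cancel₀ hn0, one_mul]

end Law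

/-! ### Identities between the random integral mappings -/

section Calculus

variable {g : ℝ → ℂ}

theorem integral_eq_integral_sq {F : ℝ → ℂ} (hF : Continuous F) :
    ∫ t in (0 : ℝ)..1, F t = ∫ u in (0 : ℝ)..1, (2 * u) • F (u ^ 2) := by
  have := intervalIntegral.integral_deriv_smul_comp (a := 0) (b := 1) (f := fun u : ℝ => u ^ 2)
    (f' := fun u => 2 * u) (g := F) (fun u _ => by simpa using hasDerivAt_pow 2 u)
    (by fun_prop) hF
  simpa using this.symm

theorem hasDerivAt_primitive (hg : Continuous g) (u : ℝ) :
    HasDerivAt (fun u => ∫ v in (0 : ℝ)..u, g v) (g u) u :=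
  intervalIntegral.integral_hasDerivAt_right (hg.intervalIntegrable _ _)
    (hg.stronglyMeasurableAtFilter _ _) hg.continuousAt

theorem continuous_primitive_of_continuous (hg : Continuous g) :
    Continuous fun u : ℝ => ∫ v in (0 : ℝ)..u, g v :=
  continuous_iff_continuousAt.2 fun u => (hasDerivAt_primitive hg u).continuousAt

/-- Integration by parts against the identity. -/
theorem integral_primitive_add (hg : Continuous g) :
    (∫ u in (0 : ℝ)..1, ∫ v in (0 : ℝ)..u, g v) + ∫ u in (0 : ℝ)..1, u • g u =
      ∫ v in (0 : ℝ)..1, g v := by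
  have hG := continuous_primitive_of_continuous hg
  rw [← intervalIntegral.integral_add (hG.intervalIntegrable _ _)
    ((by fun_prop : Continuous fun u : ℝ => u • g u).intervalIntegrable _ _)]
  have h := intervalIntegral.integral_eq_sub_of_hasDerivAt (a := 0) (b := 1)
    (f := fun u : ℝ => u • ∫ v in (0 : ℝ)..u, g v)
    (f' := fun u : ℝ => (∫ v in (0 : ℝ)..u, g v) + u • g u)
    (fun u _ => by
      simpa [add_comm] using (hasDerivAt_id' u).fun_smul (hasDerivAt_primitive hg u))
    ((hG.add (by fun_prop)).intervalIntegrable _ _)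
  simpa using h

/-- Substitute `t = u²`; one factor `u` of the Jacobian `2u` is absorbed by `v = u s`. -/
theorem integral_integral_sqrt_mul (hg : Continuous g) :
    ∫ t in (0 : ℝ)..1, ∫ s in (0 : ℝ)..1, g (√t * s) =
      2 * ∫ u in (0 : ℝ)..1, ∫ v in (0 : ℝ)..u, g v := by
  rw [integral_eq_integral_sq (intervalIntegral.continuous_parametric_intervalIntegral_of_continuous'
    (by fun_prop) 0 1), ← intervalIntegral.integral_const_mul]
  refine intervalIntegral.integral_congr fun u hu => ?_
  rw [Set.uIcc_of_le zero_le_one] at hu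
  rw [Real.sqrt_sq hu.1, mul_smul, intervalIntegral.smul_integral_comp_mul_left]
  simp

theorem integral_comp_sqrt (hg : Continuous g) :
    ∫ t in (0 : ℝ)..1, g (√t) = 2 * ∫ u in (0 : ℝ)..1, u • g u := by
  rw [integral_eq_integral_sq (by fun_prop), ← intervalIntegral.integral_const_mul]
  refine intervalIntegral.integral_congr fun u hu => ?_
  rw [Set.uIcc_of_le zero_le_one] at hu
  rw [Real.sqrt_sq hu.1, mul_smul]
  simp

/-- With `t = u²` and the reflection `u ↦ 1 - u` the left side is `2 ∫ (1 - u) g(u) du`, and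
integration by parts does the rest. -/
theorem integral_comp_one_sub_sqrt (hg : Continuous g) :
    ∫ t in (0 : ℝ)..1, g (1 - √t) = 2 * ∫ u in (0 : ℝ)..1, ∫ v in (0 : ℝ)..u, g v := by
  have hK := integral_primitive_add hg
  have h1 : ∫ t in (0 : ℝ)..1, g (1 - √t) = 2 * ∫ u in (0 : ℝ)..1, u • g (1 - u) :=
    integral_comp_sqrt (g := fun u => g (1 - u)) (by fun_prop)
  have h2 : ∫ u in (0 : ℝ)..1, u • g (1 - u) = ∫ u in (0 : ℝ)..1, (g u - u • g u) := by
    have := intervalIntegral.integral_comp_sub_left (a := 0) (b := 1)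
      (fun u : ℝ => g u - u • g u) 1
    simp only [sub_zero, sub_self] at this
    rw [← this]
    refine intervalIntegral.integral_congr fun u _ => ?_
    rw [sub_smul, one_smul, sub_sub_cancel]
  rw [h1, h2, intervalIntegral.integral_sub (hg.intervalIntegrable _ _)
    ((by fun_prop : Continuous fun u : ℝ => u • g u).intervalIntegrable _ _), ← hK]
  ring

end Calculus

/-! ### The mappings acting on exponents -/

section Identities

variable {E : Type} [NormedAddCommGroup E] [InnerProductSpace ℝ E] {β : ℝ} {ψ : E → ℂ}

theorem continuous_rpow_one_div (hβ : 0 < β) : Continuous fun t : ℝ => t ^ (1 / β) :=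
  Real.continuous_rpow_const (by positivity)

theorem rpow_one_div_two_mul {t : ℝ} (ht : 0 ≤ t) (β : ℝ) :
    t ^ (1 / (2 * β)) = √t ^ (1 / β) := by
  rw [Real.sqrt_eq_rpow, ← Real.rpow_mul ht]
  congr 1
  ring

theorem integralLog_congr {f₁ f₂ : ℝ → ℝ} (h : ∀ t ∈ Set.Icc (0 : ℝ) 1, f₁ t = f₂ t)
    (ψ : E → ℂ) : integralLog f₁ ψ = integralLog f₂ ψ := by
  ext x
  refine intervalIntegral.integral_congr fun t ht => ?_
  rw [Set.uIcc_of_le zero_le_one] at ht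
  rw [h t ht]

theorem integralLog_rpow_two_mul (β : ℝ) (ψ : E → ℂ) :
    integralLog (fun t => t ^ (1 / (2 * β))) ψ = integralLog (fun t => √t ^ (1 / β)) ψ :=
  integralLog_congr (fun _ ht => rpow_one_div_two_mul ht.1 β) ψ

theorem integralLog_sqrt_integralLog (hβ : 0 < β) (hψ : Continuous ψ) (x : E) :
    integralLog (fun t => √t ^ (1 / β)) (integralLog (fun t => t ^ (1 / β)) ψ) x =
      2 * ∫ u in (0 : ℝ)..1, ∫ v in (0 : ℝ)..u, ψ (v ^ (1 / β) • x) := by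
  have hp := continuous_rpow_one_div hβ
  rw [← integral_integral_sqrt_mul (g := fun v => ψ (v ^ (1 / β) • x)) (by fun_prop)]
  refine intervalIntegral.integral_congr fun t ht => ?_
  refine intervalIntegral.integral_congr fun s hs => ?_
  rw [Set.uIcc_of_le zero_le_one] at ht hs
  dsimp only
  rw [smul_smul, mul_comm, Real.mul_rpow (Real.sqrt_nonneg t) hs.1]

theorem integralLog_integralLog_comm {f₁ f₂ : ℝ → ℝ} (h₁ : Continuous f₁) (h₂ : Continuous f₂)
    (hψ : Continuous ψ) :
    integralLog f₁ (integralLog f₂ ψ) = integralLog f₂ (integralLog f₁ ψ) := by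
  ext x
  have hc : Continuous (Function.uncurry fun t s => ψ (f₂ s • f₁ t • x)) := by
    unfold Function.uncurry
    fun_prop
  refine (intervalIntegral_intervalIntegral_swap (a := 0) (b := 1) (c := 0) (d := 1)
    ((hc.continuousOn.integrableOn_compact (isCompact_uIcc.prod isCompact_uIcc)).mono_set
      (Set.prod_mono Set.uIoc_subset_uIcc Set.uIoc_subset_uIcc))).trans ?_
  refine intervalIntegral.integral_congr fun t _ => ?_
  refine intervalIntegral.integral_congr fun s _ => ?_
  exact congrArg ψ (smul_comm _ _ _)

/-- `𝓙^{2β} ∘ 𝓙^β` is the random integral mapping of `(1 - √t)^{1/β}`. -/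
theorem integralLog_two_mul_integralLog (hβ : 0 < β) (hψ : Continuous ψ) :
    integralLog (fun t => t ^ (1 / (2 * β))) (integralLog (fun t => t ^ (1 / β)) ψ) =
      integralLog (fun t => (1 - √t) ^ (1 / β)) ψ := by
  have hp := continuous_rpow_one_div hβ
  rw [integralLog_rpow_two_mul]
  ext x
  rw [integralLog_sqrt_integralLog hβ hψ]
  exact (integral_comp_one_sub_sqrt (g := fun v => ψ (v ^ (1 / β) • x)) (by fun_prop)).symm

/-- The identity behind both parts of the theorem: after commuting the two operators it is
integration by parts for `g v = ψ (v^(1/β) • x)`. -/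
theorem integralLog_integralLog_add (hβ : 0 < β) (hψ : Continuous ψ) (x : E) :
    integralLog (fun t => t ^ (1 / β)) (integralLog (fun t => t ^ (1 / (2 * β))) ψ) x +
      integralLog (fun t => t ^ (1 / (2 * β))) ψ x = 2 * integralLog (fun t => t ^ (1 / β)) ψ x := by
  have hp := continuous_rpow_one_div hβ
  rw [integralLog_integralLog_comm hp (continuous_rpow_one_div (by positivity)) hψ,
    integralLog_rpow_two_mul, integralLog_rpow_two_mul, integralLog_sqrt_integralLog hβ hψ]
  have h1 := integral_comp_sqrt (g := fun v => ψ (v ^ (1 / β) • x)) (by fun_prop)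
  have h2 := integral_primitive_add (g := fun v => ψ (v ^ (1 / β) • x)) (by fun_prop)
  simp only [integralLog]
  rw [h1, ← h2]
  ring

/-- The mapping `ψ ↦ 𝓙^β ψ + ψ` is injective. -/
theorem eq_zero_of_integralLog_add_eq_zero (hβ : 0 < β) (hψ : Continuous ψ)
    (h : ∀ x, integralLog (fun t => t ^ (1 / β)) ψ x + ψ x = 0) (x : E) : ψ x = 0 := by
  have hp := continuous_rpow_one_div hβ
  set g : ℝ → ℂ := fun v => ψ (v ^ (1 / β) • x) with hg
  have hgc : Continuous g := by fun_prop
  -- The hypothesis at the point `u^(1/β) • x` of the ray, multiplied by `u`.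
  have key : ∀ u ∈ Set.Icc (0 : ℝ) 1, (∫ v in (0 : ℝ)..u, g v) + u • g u = 0 := by
    intro u hu
    have h1 : integralLog (fun t => t ^ (1 / β)) ψ (u ^ (1 / β) • x) =
        ∫ t in (0 : ℝ)..1, g (u * t) := by
      refine intervalIntegral.integral_congr fun t ht => ?_
      rw [Set.uIcc_of_le zero_le_one] at ht
      simp only [hg]
      rw [smul_smul, mul_comm, Real.mul_rpow hu.1 ht.1]
    have h2 := congrArg (fun z => u • z) (h (u ^ (1 / β) • x))
    simp only [smul_add, smul_zero] at h2
    rw [h1, intervalIntegral.smul_integral_comp_mul_left] at h2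
    simp only [mul_zero, mul_one] at h2
    exact h2
  -- Integrated over `[0, 1]`, the left side of `key` is `∫ g` by parts. Then `key` at `u = 1`
  -- leaves `g 1 = ψ x = 0`.
  have h0 : ∫ v in (0 : ℝ)..1, g v = 0 := by
    rw [← integral_primitive_add hgc, ← intervalIntegral.integral_add
      ((continuous_primitive_of_continuous hgc).intervalIntegrable _ _)
      ((by fun_prop : Continuous fun u : ℝ => u • g u).intervalIntegrable _ _)]
    rw [intervalIntegral.integral_congr (g := fun _ => (0 : ℂ)) fun u hu => key u (by
      rwa [Set.uIcc_of_le zero_le_one] at hu)]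
    simp
  have h1 := key 1 (by simp)
  rw [h0] at h1
  simpa [hg] using h1

end Identities

/-! ### The factorization property and the class identities -/

section Main

variable {E : Type} [NormedAddCommGroup E] [InnerProductSpace ℝ E] [FiniteDimensional ℝ E]
  [MeasurableSpace E] [BorelSpace E] {β : ℝ}

theorem monotoneOn_rpow_one_div (hβ : 0 < β) :
    MonotoneOn (fun t : ℝ => t ^ (1 / β)) (Set.Icc 0 1) := fun a ha b _ hab =>
  Real.rpow_le_rpow ha.1 hab (by positivity)

theorem antitoneOn_one_sub_sqrt_rpow (hβ : 0 < β) :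
    AntitoneOn (fun t : ℝ => (1 - √t) ^ (1 / β)) (Set.Icc 0 1) := fun a _ b hb hab =>
  Real.rpow_le_rpow (sub_nonneg.2 (Real.sqrt_le_one.2 hb.2))
    (sub_le_sub_left (Real.sqrt_le_sqrt hab) 1) (by positivity)

theorem isJ_iff (hβ : 0 < β) {ν μ : Measure E} {ψ : E → ℂ} (hν : ν ∈ ID E)
    (hψ : IsLogChar ν ψ) : IsJ β ν μ ↔ IsLogChar μ (integralLog (fun t => t ^ (1 / β)) ψ) :=
  isRandomIntegralLaw_iff (continuous_rpow_one_div hβ) (Or.inl (monotoneOn_rpow_one_div hβ)) hν hψ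

theorem exists_isJ (hβ : 0 < β) {ν : Measure E} (hν : ν ∈ ID E) : ∃ μ, IsJ β ν μ :=
  exists_isRandomIntegralLaw (continuous_rpow_one_div hβ) (Or.inl (monotoneOn_rpow_one_div hβ)) hν

theorem IsJ.mem_ID (hβ : 0 < β) {ν μ : Measure E} (hν : ν ∈ ID E) (h : IsJ β ν μ) : μ ∈ ID E :=
  IsRandomIntegralLaw.mem_ID (continuous_rpow_one_div hβ) (Or.inl (monotoneOn_rpow_one_div hβ)) hν h

/-- `𝓙^β(𝓙^{2β}(ν)) * 𝓙^{2β}(ν) = 𝓙^β(ν * ν)`. -/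
theorem IsJ.isLogChar_conv (hβ : 0 < β) {ν ρ κ : Measure E} {ψ : E → ℂ} (hν : ν ∈ ID E)
    (hψ : IsLogChar ν ψ) (hρ : IsJ (2 * β) ν ρ) (hκ : IsJ β ρ κ) :
    IsLogChar (κ ∗ ρ) (fun x => 2 * integralLog (fun t => t ^ (1 / β)) ψ x) := by
  have h2β : 0 < 2 * β := by positivity
  have hρl := (isJ_iff h2β hν hψ).1 hρ
  have hκl := (isJ_iff hβ (hρ.mem_ID h2β hν) hρl).1 hκ
  convert hκl.conv hρl using 2 with x
  exact (integralLog_integralLog_add hβ hψ.cont x).symm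

theorem IsJ.isJ_conv_self (hβ : 0 < β) {ν ρ κ : Measure E} (hν : ν ∈ ID E)
    (hρ : IsJ (2 * β) ν ρ) (hκ : IsJ β ρ κ) : IsJ β (ν ∗ ν) (κ ∗ ρ) := by
  obtain ⟨ψ, hψ⟩ := exists_isLogChar hν
  rw [isJ_iff hβ (conv_self_mem_ID hν) (hψ.conv hψ)]
  simp only [← two_mul, integralLog_const_mul]
  exact hρ.isLogChar_conv hβ hν hψ hκ

theorem classUf_eq (hβ : 0 < β) : classUf E β = imageJ (2 * β) (classU E β) := by
  have h2β : 0 < 2 * β := by positivity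
  ext μ
  constructor
  · rintro ⟨ρ, hρ, hμ, ν, hν, hJ⟩
    obtain ⟨ψρ, hψρ⟩ := exists_isLogChar hρ
    obtain ⟨ψν, hψν⟩ := exists_isLogChar hν
    obtain ⟨κ, hκ, hψκ⟩ := exists_root_mem_ID hν hψν two_ne_zero
    set ψ : E → ℂ := fun x => ψν x / (2 : ℕ) with hψdef
    have hμl := (isJ_iff hβ hρ hψρ).1 hμ
    have hJl := (isJ_iff hβ hν hψν).1 hJ
    have e1 := (hμl.conv hψρ).unique hJl
    have e2 : integralLog (fun t => t ^ (1 / β)) ψν =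
        fun x => 2 * integralLog (fun t => t ^ (1 / β)) ψ x := by
      rw [← integralLog_const_mul]
      congr 1
      ext x
      simp only [hψdef]
      push_cast
      ring
    have hc2 := continuous_integralLog (continuous_rpow_one_div h2β) hψκ.cont
    -- Both `ψρ` and the `𝓙^{2β}`-image of the halved exponent `ψ` solve `𝓙^β χ + χ = 2 𝓙^β ψ`;
    -- injectivity applied to their difference makes them equal.
    have hρψ : ψρ = integralLog (fun t => t ^ (1 / (2 * β))) ψ := by
      ext x
      refine sub_eq_zero.1 (eq_zero_of_integralLog_add_eq_zero hβ
        (ψ := fun x => ψρ x - integralLog (fun t => t ^ (1 / (2 * β))) ψ x)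
        (hψρ.cont.sub hc2) (fun x => ?_) x)
      have h1 := congrFun e1 x
      have h2 := integralLog_integralLog_add hβ hψκ.cont x
      rw [e2] at h1
      have h3 : integralLog (fun t => t ^ (1 / β))
          (fun x => ψρ x - integralLog (fun t => t ^ (1 / (2 * β))) ψ x) x =
          integralLog (fun t => t ^ (1 / β)) ψρ x - integralLog (fun t => t ^ (1 / β))
            (integralLog (fun t => t ^ (1 / (2 * β))) ψ) x := by
        have hp := continuous_rpow_one_div hβ
        have hc1 := hψρ.cont
        exact intervalIntegral.integral_sub
          ((by fun_prop : Continuous fun t : ℝ => ψρ (t ^ (1 / β) • x)).intervalIntegrable _ _)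
          ((by fun_prop : Continuous fun t : ℝ => integralLog (fun t => t ^ (1 / (2 * β))) ψ
            (t ^ (1 / β) • x)).intervalIntegrable _ _)
      rw [h3]
      linear_combination h1 - h2
    obtain ⟨ν', hν'⟩ := exists_isJ hβ hκ
    refine ⟨ν', ⟨κ, hκ, hν'⟩, (isJ_iff h2β (hν'.mem_ID hβ hκ) ((isJ_iff hβ hκ hψκ).1 hν')).2 ?_⟩
    rw [integralLog_integralLog_comm (continuous_rpow_one_div h2β) (continuous_rpow_one_div hβ)
      hψκ.cont, ← hρψ]
    exact hμl
  · rintro ⟨ν', ⟨ν, hν, hν'⟩, hμ⟩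
    obtain ⟨ψ, hψ⟩ := exists_isLogChar hν
    obtain ⟨ρ, hρ⟩ := exists_isJ h2β hν
    have hρID := hρ.mem_ID h2β hν
    have hμl := (isJ_iff h2β (hν'.mem_ID hβ hν) ((isJ_iff hβ hν hψ).1 hν')).1 hμ
    have hJ : IsJ β ρ μ := by
      rw [isJ_iff hβ hρID ((isJ_iff h2β hν hψ).1 hρ),
        integralLog_integralLog_comm (continuous_rpow_one_div hβ) (continuous_rpow_one_div h2β)
          hψ.cont]
      exact hμl
    exact ⟨ρ, hρID, hJ, ν ∗ ν, conv_self_mem_ID hν, hρ.isJ_conv_self hβ hν hJ⟩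

theorem imageJ_imageJ_eq (hβ : 0 < β) : imageJ (2 * β) (imageJ β (ID E)) =
    {μ | ∃ ν ∈ ID E, IsRandomIntegralLaw (fun t => (1 - √t) ^ (1 / β)) ν μ} := by
  have h2β : 0 < 2 * β := by positivity
  have hp := continuous_rpow_one_div hβ
  have hf : Continuous fun t : ℝ => (1 - √t) ^ (1 / β) :=
    hp.comp (by fun_prop : Continuous fun t : ℝ => 1 - √t)
  have key : ∀ ν ∈ ID E, ∀ ν', IsJ β ν ν' → ∀ μ, IsJ (2 * β) ν' μ ↔
      IsRandomIntegralLaw (fun t => (1 - √t) ^ (1 / β)) ν μ := by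
    intro ν hν ν' hν' μ
    obtain ⟨ψ, hψ⟩ := exists_isLogChar hν
    rw [isJ_iff h2β (hν'.mem_ID hβ hν) ((isJ_iff hβ hν hψ).1 hν'),
      integralLog_two_mul_integralLog hβ hψ.cont,
      isRandomIntegralLaw_iff hf (Or.inr (antitoneOn_one_sub_sqrt_rpow hβ)) hν hψ]
  ext μ
  constructor
  · rintro ⟨ν', ⟨ν, hν, hν'⟩, hμ⟩
    exact ⟨ν, hν, (key ν hν ν' hν' μ).1 hμ⟩
  · rintro ⟨ν, hν, hμ⟩
    obtain ⟨ν', hν'⟩ := exists_isJ hβ hν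
    exact ⟨ν', ⟨ν, hν, hν'⟩, (key ν hν ν' hν' μ).2 hμ⟩

theorem classU_eq (hβ : 0 < β) : classU E β =
    {μ | ∃ ρ ∈ classU E (2 * β), ∃ κ, IsJ β ρ κ ∧ μ = κ ∗ ρ} := by
  have h2β : 0 < 2 * β := by positivity
  ext μ
  constructor
  · rintro ⟨ν, hν, hμ⟩
    obtain ⟨ψ, hψ⟩ := exists_isLogChar hν
    -- The square root compensates the factor `2` in `IsJ.isLogChar_conv`.
    obtain ⟨σ, hσ, hψσ⟩ := exists_root_mem_ID hν hψ two_ne_zero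
    obtain ⟨ρ, hρ⟩ := exists_isJ h2β hσ
    obtain ⟨κ, hκ⟩ := exists_isJ hβ (hρ.mem_ID h2β hσ)
    refine ⟨ρ, ⟨σ, hσ, hρ⟩, κ, hκ, ((isJ_iff hβ hν hψ).1 hμ).measure_eq ?_⟩
    have := hρ.isLogChar_conv hβ hσ hψσ hκ
    rw [← integralLog_const_mul] at this
    convert this using 3
    push_cast
    ring
  · rintro ⟨ρ, ⟨ν, hν, hρ⟩, κ, hκ, rfl⟩
    exact ⟨ν ∗ ν, conv_self_mem_ID hν, hρ.isJ_conv_self hβ hν hκ⟩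

end Main

theorem corollary1 (d : ℕ) (β : ℝ) (hβ : 0 < β) :
    (classUf (EuclideanSpace ℝ (Fin d)) β
        = imageJ (2 * β) (classU (EuclideanSpace ℝ (Fin d)) β) ∧
      imageJ (2 * β) (classU (EuclideanSpace ℝ (Fin d)) β)
        = imageJ (2 * β) (imageJ β (ID (EuclideanSpace ℝ (Fin d)))) ∧
      imageJ (2 * β) (imageJ β (ID (EuclideanSpace ℝ (Fin d))))
        = {μ | ∃ ν ∈ ID (EuclideanSpace ℝ (Fin d)),
            IsRandomIntegralLaw (fun t => (1 - √t) ^ (1 / β)) ν μ}) ∧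
    classU (EuclideanSpace ℝ (Fin d)) β
      = {μ | ∃ ρ ∈ classU (EuclideanSpace ℝ (Fin d)) (2 * β),
          ∃ κ, IsJ β ρ κ ∧ μ = κ ∗ ρ} :=
  ⟨⟨classUf_eq hβ, rfl, imageJ_imageJ_eq hβ⟩, classU_eq hβ⟩
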